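/- Let $K\ge 1$. A homeomorphism $\phi:\mathbb C\to\mathbb C$ is called $K$-quasiconformal if it belongs to $W^{1,2}_{\mathrm{loc}}(\mathbb C)$, is orientation preserving (its Jacobian is $\ge 0$ a.e.), and its directional derivatives satisfy $\max_\alpha|\partial_\alpha\phi|\le K\min_\alpha|\partial_\alpha\phi|$ a.e. in $\mathbb C$. Let $\mathcal H^s$ denote $s$-dimensional Hausdorff measure on $\mathbb C$; a set is $\mathcal H^s$-$\sigma$-finite if it is a countable union of sets of finite $\mathcal H^s$ measure. **Corollary 3.5.** There exist a compact set $F\subset\mathbb C$ and a $K$-quasiconformal mapping $\phi:\mathbb C\to\mathbb C$ such that $\mathcal H^{\frac{2}{K+1}}(F)=\infty$ but $F$ is $\mathcal H^{\frac{2}{K+1}}$-$\sigma$-finite, and $\mathcal H^{1}(\phi(F))=\infty$ but $\phi(F)$ is $\mathcal H^{1}$-$\sigma$-finite. More generally, for every $0<d<2$, with $d'=\frac{2Kd}{2+(K-1)d}$, there exist a compact set $F\subset\mathbb C$ and a $K$-quasiconformal mapping $\phi:\mathbb C\to\mathbb C$ such that $\mathcal H^{d}(F)=\infty$ but $F$ is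 $\mathcal H^{d}$-$\sigma$-finite, and $\mathcal H^{d'}(\phi(F))=\infty$ but $\phi(F)$ is $\mathcal H^{d'}$-$\sigma$-finite. -/

import Mathlib

open MeasureTheory
open scoped ContDiff

/-- `f` belongs to `L²` on every compact subset of the plane. -/
def MemL2Loc {E : Type*} [NormedAddCommGroup E] (f : ℂ → E) : Prop :=
  ∀ S : Set ℂ, IsCompact S → MemLp f 2 (volume.restrict S)

/-- `f : ℂ → ℂ` belongs to the Sobolev space `W^{1,2}_loc(ℂ)`, with distributional (real) derivative
`Df`: both are locally square integrable, and
`∫ (∂ᵥ ψ) f = - ∫ ψ (Df v)` for every test function `ψ` and every direction `v`. -/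
structure HasSobolevDeriv (f : ℂ → ℂ) (Df : ℂ → ℂ →L[ℝ] ℂ) : Prop where
  memL2Loc : MemL2Loc f
  deriv_memL2Loc : MemL2Loc Df
  integral_eq : ∀ ψ : ℂ → ℝ, ContDiff ℝ ∞ ψ → HasCompactSupport ψ → ∀ v : ℂ,
    ∫ z, (fderiv ℝ ψ z v) • f z = -∫ z, ψ z • Df z v

/-- A homeomorphism `φ` of the plane is `K`-quasiconformal: it lies in `W^{1,2}_loc(ℂ)`, it is
orientation preserving (its Jacobian determinant is nonnegative almost everywhere), and its
directional derivatives `∂_α φ(z) = Dφ(z) (exp (i α))` satisfy the distortion inequality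
`max_α |∂_α φ| ≤ K min_α |∂_α φ|` almost everywhere. -/
def IsQuasiconformal (K : ℝ) (φ : ℂ ≃ₜ ℂ) : Prop :=
  ∃ Dφ : ℂ → ℂ →L[ℝ] ℂ, HasSobolevDeriv φ Dφ ∧
    (∀ᵐ z, 0 ≤ (Dφ z).det) ∧
    (∀ᵐ z, ∀ v w : ℂ, ‖v‖ = 1 → ‖w‖ = 1 → ‖Dφ z v‖ ≤ K * ‖Dφ z w‖)

/-! The map is an infinite composition of radial stretches. In a disc of radius `s`, the map
modelled on `z‖z‖^(1/K - 1)` is the identity outside, has distortion `K`, and carries the concentric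
disc of radius `σ^K s` by a similarity onto the one of radius `σ s`. Packing disjoint discs of
relative radii `r` into the inner disc and iterating yields a Cantor set with ratios `σ^K r` in the
source, mapped onto one with ratios `σ r` in the target.

Write `S = ∑ r²` for a packing and choose `σ` so that `(σ r)^d' = r² / S`; the target sums are then
exactly 1. With `γ = (K-1)d/2` one has `K d = d'(1 + γ)`, hence `(σ^K r)^d = (r² / S) S^(-γ)`. If
the packings fill the discs so well that `∏ S_n^(-γ)` stays bounded, both Cantor sets have finite
measure (`IsDiscCode.hausdorffMeasure_range_lt_top`). Positivity comes from the product measure with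
weights `r² / S`: disjointness of the discs compares areas and gives a Frostman bound
(`IsDiscCode.infinitePi_preimage_le`).

To make the measures infinite but σ-finite, copies are placed in disjoint annuli shrinking to 0.
Since `d, d' < 2`, a packing by tiny discs has total size at least 1 in both dimensions, so each
annulus contributes at least the measure of one Cantor set (`hausdorffMeasure_copies`). Adding the
point 0 makes the union compact.

On each disc of stage `N` the map built so far is a similarity, so composing with a new stretch
keeps the distortion at most `K` and does not decrease the norm of the differential. The stages
converge uniformly together with their inverses, and almost every point leaves the discs eventually.
The energy is bounded by `K` times the area of the image, which gives the Sobolev property in the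
limit (`isQuasiconformal_of_eventuallyEq`, `exists_isQuasiconformal`). -/

open Filter Topology Metric Set

/-! ### Linear algebra of the distortion condition. -/

/-- Pointwise distortion condition on a differential of an orientation preserving map: nonnegative
determinant, the analytic inequality `‖A‖² ≤ K det A`, and `K`-bounded eccentricity. -/
structure HasDistortion (K : ℝ) (A : ℂ →L[ℝ] ℂ) : Prop where
  det_nonneg : 0 ≤ A.det
  norm_sq_le : ‖A‖ ^ 2 ≤ K * A.det
  norm_apply_le : ∀ v w : ℂ, ‖v‖ = 1 → ‖w‖ = 1 → ‖A v‖ ≤ K * ‖A w‖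

theorem det_smul_clm (c : ℝ) (A : ℂ →L[ℝ] ℂ) : (c • A).det = c ^ 2 * A.det := by
  have : ((c • A : ℂ →L[ℝ] ℂ) : ℂ →ₗ[ℝ] ℂ) = c • (A : ℂ →ₗ[ℝ] ℂ) := rfl
  rw [ContinuousLinearMap.det, this, LinearMap.det_smul, Complex.finrank_real_complex]

theorem HasDistortion.smul {K : ℝ} {A : ℂ →L[ℝ] ℂ} (h : HasDistortion K A) (c : ℝ) :
    HasDistortion K (c • A) where
  det_nonneg := by
    rw [det_smul_clm]
    exact mul_nonneg (sq_nonneg _) h.det_nonneg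
  norm_sq_le := by
    rw [det_smul_clm, norm_smul, mul_pow, Real.norm_eq_abs, sq_abs]
    nlinarith [mul_le_mul_of_nonneg_left h.norm_sq_le (sq_nonneg c)]
  norm_apply_le v w hv hw := by
    simp only [smul_apply, norm_smul]
    nlinarith [mul_le_mul_of_nonneg_left (h.norm_apply_le v w hv hw) (norm_nonneg c)]

/-- The differential of the radial map `z ↦ z * ‖z‖ ^ (q - 1)` at a point of the unit circle:
multiplication by `q` in the radial direction `e`, the identity in the tangential direction. -/
noncomputable def radialScaling (e : ℂ) (q : ℝ) : ℂ →L[ℝ] ℂ :=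
  ContinuousLinearMap.id ℝ ℂ + (q - 1) • (innerSL ℝ e).smulRight e

theorem radialScaling_apply (e : ℂ) (q : ℝ) (v : ℂ) :
    radialScaling e q v = v + (q - 1) • (inner ℝ e v) • e := by
  simp [radialScaling]

theorem norm_sq_radialScaling {e : ℂ} (he : ‖e‖ = 1) (q : ℝ) (v : ℂ) :
    ‖radialScaling e q v‖ ^ 2 = ‖v‖ ^ 2 - (1 - q ^ 2) * (inner ℝ e v) ^ 2 := by
  rw [radialScaling_apply, norm_add_sq_real, smul_smul, inner_smul_right, norm_smul, he,
    real_inner_comm, mul_one, Real.norm_eq_abs, sq_abs]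
  ring

theorem det_radialScaling {e : ℂ} (he : ‖e‖ = 1) (q : ℝ) : (radialScaling e q).det = q := by
  have h1 : e.re ^ 2 + e.im ^ 2 = 1 := by
    have := Complex.sq_norm e
    rw [he, Complex.normSq_apply] at this
    linarith
  rw [ContinuousLinearMap.det, ← LinearMap.det_toMatrix Complex.basisOneI, Matrix.det_fin_two]
  simp [LinearMap.toMatrix_apply, radialScaling_apply, Complex.inner]
  linear_combination (q - 1) * h1

/-- The singular values are `K⁻¹` (radial) and 1 (tangential), so the determinant is `K⁻¹` and `‖A‖²
≤ 1 = K · K⁻¹`. -/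
theorem hasDistortion_radialScaling {e : ℂ} (he : ‖e‖ = 1) {K : ℝ} (hK : 1 ≤ K) :
    HasDistortion K (radialScaling e K⁻¹) := by
  have hK0 : 0 < K := by linarith
  have hq : K⁻¹ ≤ 1 := inv_le_one_of_one_le₀ hK
  have hq0 : 0 < K⁻¹ := inv_pos.2 hK0
  have hq2 : K⁻¹ ^ 2 ≤ 1 := by nlinarith
  have hle (v : ℂ) : ‖radialScaling e K⁻¹ v‖ ≤ ‖v‖ := by
    refine le_of_sq_le_sq ?_ (norm_nonneg _)
    rw [norm_sq_radialScaling he]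
    nlinarith [mul_nonneg (sub_nonneg.2 hq2) (sq_nonneg (inner ℝ e v))]
  have hge (v : ℂ) : K⁻¹ * ‖v‖ ≤ ‖radialScaling e K⁻¹ v‖ := by
    refine le_of_sq_le_sq ?_ (norm_nonneg _)
    rw [norm_sq_radialScaling he, mul_pow]
    have : (inner ℝ e v) ^ 2 ≤ ‖v‖ ^ 2 := by
      have := abs_real_inner_le_norm e v
      rw [he, one_mul] at this
      rw [← sq_abs]
      gcongr
    nlinarith [mul_nonneg (sub_nonneg.2 hq2) (sub_nonneg.2 this)]
  refine ⟨by rw [det_radialScaling he]; exact hq0.le, ?_, fun v w hv hw ↦ ?_⟩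
  · rw [det_radialScaling he, mul_inv_cancel₀ hK0.ne']
    have : ‖radialScaling e K⁻¹‖ ≤ 1 :=
      ContinuousLinearMap.opNorm_le_bound _ zero_le_one fun v ↦ by simpa using hle v
    exact pow_le_one₀ (norm_nonneg _) this
  · have h1 := hle v
    have h2 := hge w
    rw [hv] at h1
    rw [hw, mul_one] at h2
    calc _ ≤ 1 := h1
      _ = K * K⁻¹ := (mul_inv_cancel₀ hK0.ne').symm
      _ ≤ _ := by gcongr

/-- The tangential vector `I * e` is fixed. This bound makes the norms of the differentials increase
from stage to stage. -/
theorem one_le_norm_radialScaling {e : ℂ} (he : ‖e‖ = 1) (q : ℝ) : 1 ≤ ‖radialScaling e q‖ := by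
  have h := (radialScaling e q).le_opNorm (Complex.I * e)
  have h2 : radialScaling e q (Complex.I * e) = Complex.I * e := by
    rw [radialScaling_apply]
    have : inner ℝ e (Complex.I * e) = (0 : ℝ) := by
      simp [Complex.inner]
      ring
    simp [this]
  simpa [h2, he] using h

theorem hasDistortion_id {K : ℝ} (hK : 1 ≤ K) :
    HasDistortion K (ContinuousLinearMap.id ℝ ℂ) := by
  have hdet : (ContinuousLinearMap.id ℝ ℂ).det = 1 := by
    simp [ContinuousLinearMap.det]
  refine ⟨by simp [hdet], by simpa [hdet], fun v w hv hw ↦ by simpa [hv, hw]⟩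

/-! ### The radial stretch of the unit disc -/

/-- The radial map equal to the identity off the unit disc, to `z ↦ z * ‖z‖ ^ (q - 1)` on the
annulus `a ≤ ‖z‖ ≤ 1`, and to a similarity on the disc of radius `a`. -/
noncomputable def radialStretch (a q : ℝ) (z : ℂ) : ℂ :=
  (max a (min ‖z‖ 1) ^ (q - 1)) • z

section radialStretch

variable {a q : ℝ}

theorem radialStretch_of_norm_le (ha1 : a ≤ 1) {z : ℂ} (hz : ‖z‖ ≤ a) :
    radialStretch a q z = a ^ (q - 1) • z := by
  rw [radialStretch, min_eq_left (hz.trans ha1), max_eq_left hz]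

theorem radialStretch_of_mem_annulus {z : ℂ} (hz : a ≤ ‖z‖) (hz1 : ‖z‖ ≤ 1) :
    radialStretch a q z = ‖z‖ ^ (q - 1) • z := by
  rw [radialStretch, min_eq_left hz1, max_eq_right hz]

theorem radialStretch_of_one_le (ha1 : a ≤ 1) {z : ℂ} (hz : 1 ≤ ‖z‖) :
    radialStretch a q z = z := by
  rw [radialStretch, min_eq_right hz, max_eq_right ha1, Real.one_rpow, one_smul]

theorem norm_radialStretch_of_mem_annulus (ha : 0 < a) {z : ℂ} (hz : a ≤ ‖z‖) (hz1 : ‖z‖ ≤ 1) :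
    ‖radialStretch a q z‖ = ‖z‖ ^ q := by
  have h0 : 0 < ‖z‖ := ha.trans_le hz
  rw [radialStretch_of_mem_annulus hz hz1, norm_smul, Real.norm_of_nonneg (by positivity)]
  nth_rw 2 [← Real.rpow_one ‖z‖]
  rw [← Real.rpow_add h0, sub_add_cancel]

theorem continuous_radialStretch (ha : 0 < a) : Continuous (radialStretch a q) := by
  unfold radialStretch
  refine Continuous.smul (Continuous.rpow_const (by fun_prop) fun z ↦ Or.inl ?_) continuous_id
  exact (lt_max_of_lt_left ha).ne'

theorem norm_radialStretch_le_one (ha : 0 < a) (ha1 : a ≤ 1) (hq : 0 < q) {z : ℂ} (hz : ‖z‖ ≤ 1) :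
    ‖radialStretch a q z‖ ≤ 1 := by
  rcases le_total a ‖z‖ with h | h
  · rw [norm_radialStretch_of_mem_annulus ha h hz]
    exact Real.rpow_le_one (norm_nonneg _) hz hq.le
  · rw [radialStretch_of_norm_le ha1 h, norm_smul, Real.norm_of_nonneg (by positivity)]
    calc a ^ (q - 1) * ‖z‖ ≤ a ^ (q - 1) * a ^ (1 : ℝ) := by rw [Real.rpow_one]; gcongr
      _ = a ^ q := by rw [← Real.rpow_add ha, sub_add_cancel]
      _ ≤ 1 := Real.rpow_le_one ha.le ha1 hq.le

/-- On the annulus the norm becomes `‖z‖ ^ q`, so the inverse has exponent `q⁻¹` and inner radius `a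
^ q`. -/
theorem radialStretch_radialStretch (ha : 0 < a) (ha1 : a ≤ 1) (hq : 0 < q) (z : ℂ) :
    radialStretch (a ^ q) q⁻¹ (radialStretch a q z) = z := by
  have haq : a ^ q ≤ 1 := Real.rpow_le_one ha.le ha1 hq.le
  have hmul : q * (q⁻¹ - 1) = 1 - q := by field_simp
  rcases le_total 1 ‖z‖ with h1 | h1
  · rw [radialStretch_of_one_le ha1 h1, radialStretch_of_one_le haq h1]
  rcases le_total a ‖z‖ with h | h
  · have h0 : 0 < ‖z‖ := ha.trans_le h
    have hn := norm_radialStretch_of_mem_annulus (q := q) ha h h1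
    rw [radialStretch_of_mem_annulus (a := a ^ q)]
    · rw [hn, radialStretch_of_mem_annulus h h1, ← Real.rpow_mul h0.le, hmul, smul_smul,
        ← Real.rpow_add h0]
      simp
    · rw [hn]
      gcongr
    · rw [hn]
      exact Real.rpow_le_one h0.le h1 hq.le
  · have hn : ‖radialStretch a q z‖ ≤ a ^ q := by
      rw [radialStretch_of_norm_le ha1 h, norm_smul, Real.norm_of_nonneg (by positivity)]
      calc a ^ (q - 1) * ‖z‖ ≤ a ^ (q - 1) * a ^ (1 : ℝ) := by rw [Real.rpow_one]; gcongr
        _ = a ^ q := by rw [← Real.rpow_add ha, sub_add_cancel]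
    rw [radialStretch_of_norm_le haq hn, radialStretch_of_norm_le ha1 h, ← Real.rpow_mul ha.le,
      hmul, smul_smul, ← Real.rpow_add ha]
    simp

/-- Clamping to `[a, 1]` is 1-Lipschitz, and `x ^ p` is continuously differentiable on that compact
interval, away from 0. -/
theorem exists_abs_clamp_rpow_sub_le (ha : 0 < a) (ha1 : a ≤ 1) (p : ℝ) :
    ∃ C : ℝ, 0 ≤ C ∧ ∀ x y : ℝ,
      |max a (min x 1) ^ p - max a (min y 1) ^ p| ≤ C * |x - y| := by
  have hc : ContDiffOn ℝ 1 (fun x : ℝ ↦ x ^ p) (Icc a 1) := fun x hx ↦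
    (Real.contDiffAt_rpow_const_of_ne (ha.trans_le hx.1).ne').contDiffWithinAt
  obtain ⟨C, hC⟩ := hc.exists_lipschitzOnWith one_ne_zero (convex_Icc a 1) isCompact_Icc
  refine ⟨C, C.2, fun x y ↦ ?_⟩
  have hm (x : ℝ) : max a (min x 1) ∈ Icc a 1 := ⟨le_max_left _ _, max_le ha1 (min_le_right _ _)⟩
  have h := hC.dist_le_mul _ (hm x) _ (hm y)
  simp only [Real.dist_eq] at h
  refine h.trans (mul_le_mul_of_nonneg_left ?_ C.2)
  refine (abs_max_sub_max_le_max _ _ _ _).trans ?_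
  simp only [sub_self, abs_zero]
  refine max_le (abs_nonneg _) ((abs_min_sub_min_le_max _ _ _ _).trans ?_)
  simp

theorem exists_lipschitzWith_radialStretch (ha : 0 < a) (ha1 : a ≤ 1) :
    ∃ C, LipschitzWith C (radialStretch a q) := by
  obtain ⟨C, hC0, hC⟩ := exists_abs_clamp_rpow_sub_le ha ha1 (q - 1)
  set g : ℝ → ℝ := fun x ↦ max a (min x 1) ^ (q - 1) with hg
  have hg1 : g 1 = 1 := by simp [hg, ha1]
  have hbd (x : ℝ) (h0 : 0 ≤ x) (h1 : x ≤ 1) : |g x| ≤ 1 + C := by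
    have h := hC x 1
    change |g x - g 1| ≤ _ at h
    have h2 : |g x| ≤ |g x - g 1| + |g 1| := by simpa using abs_add_le (g x - g 1) (g 1)
    have h3 : |x - 1| ≤ 1 := by rw [abs_le]; constructor <;> linarith
    rw [hg1] at h h2
    simp only [abs_one] at h2
    nlinarith
  -- One point in the unit disc suffices: the factor `‖z‖` multiplying the variation of `g` must be
  -- bounded. If both points lie outside, the map is the identity.
  have key (z w : ℂ) (hz : ‖z‖ ≤ 1) :
      ‖radialStretch a q z - radialStretch a q w‖ ≤ (1 + 2 * C) * ‖z - w‖ := by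
    have hzw : |‖z‖ - ‖w‖| ≤ ‖z - w‖ := abs_norm_sub_norm_le z w
    have hw : |g ‖w‖| ≤ 1 + C := by
      rcases le_total ‖w‖ 1 with h | h
      · exact hbd _ (norm_nonneg _) h
      · have : g ‖w‖ = 1 := by simp [hg, h, ha1]
        rw [this, abs_one]; linarith
    have e : radialStretch a q z - radialStretch a q w
        = g ‖w‖ • (z - w) + (g ‖z‖ - g ‖w‖) • z := by
      simp only [radialStretch, hg]
      module
    rw [e]
    refine (norm_add_le _ _).trans ?_
    rw [norm_smul, norm_smul, Real.norm_eq_abs, Real.norm_eq_abs]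
    have h1 : |g ‖z‖ - g ‖w‖| * ‖z‖ ≤ C * ‖z - w‖ * 1 := by
      gcongr
      exact (hC _ _).trans (by gcongr)
    nlinarith [mul_le_mul_of_nonneg_right hw (norm_nonneg (z - w))]
  refine ⟨⟨1 + 2 * C, by positivity⟩, LipschitzWith.of_dist_le_mul fun z w ↦ ?_⟩
  rw [dist_eq_norm, dist_eq_norm]
  change _ ≤ (1 + 2 * C) * ‖z - w‖
  rcases le_total ‖z‖ 1 with hz | hz
  · exact key z w hz
  rcases le_total ‖w‖ 1 with hw | hw
  · rw [norm_sub_rev, norm_sub_rev z]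
    exact key w z hw
  · rw [radialStretch_of_one_le ha1 hz, radialStretch_of_one_le ha1 hw]
    nlinarith [norm_nonneg (z - w)]

theorem hasFDerivAt_norm_rpow_smul (q : ℝ) {z : ℂ} (hz : z ≠ 0) :
    HasFDerivAt (fun z : ℂ ↦ ‖z‖ ^ (q - 1) • z)
      (‖z‖ ^ (q - 1) • radialScaling (‖z‖⁻¹ • z) q) z := by
  have hz0 : 0 < ‖z‖ := norm_pos_iff.2 hz
  -- The power of the norm is differentiated as a power of the smooth function `‖z‖ ^ 2`.
  have h1 : HasFDerivAt (fun z : ℂ ↦ ‖z‖ ^ 2) (2 • innerSL ℝ z) z :=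
    (hasStrictFDerivAt_norm_sq z).hasFDerivAt
  have h2 := h1.rpow_const (p := (q - 1) / 2) (Or.inl (by positivity))
  have h3 := h2.smul (hasFDerivAt_id z)
  have e : ∀ z : ℂ, (‖z‖ ^ 2) ^ ((q - 1) / 2) = ‖z‖ ^ (q - 1) := fun z ↦ by
    rw [← Real.rpow_natCast, ← Real.rpow_mul (norm_nonneg _)]
    congr 1; push_cast; ring
  have e2 : (‖z‖ ^ 2) ^ ((q - 1) / 2 - 1) = ‖z‖ ^ (q - 1) * (‖z‖⁻¹) ^ 2 := by
    rw [Real.rpow_sub (by positivity), e, Real.rpow_one, div_eq_mul_inv, inv_pow]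
  simp only [e] at h3
  refine HasFDerivAt.congr_fderiv (f' := _) h3 ?_
  ext1 v
  rw [e2]
  simp only [smul_apply, radialScaling_apply, add_apply,
    ContinuousLinearMap.smulRight_apply, inner_smul_left, ContinuousLinearMap.id_apply, id,
    innerSL_apply_apply, nsmul_eq_mul, smul_eq_mul, conj_trivial, smul_smul, smul_add]
  congr 2
  push_cast
  ring

/-- At almost every point the radial stretch has a differential of distortion at most `K` which
does not contract all directions. -/
theorem radialStretch_differential {K : ℝ} (hK : 1 ≤ K) (ha : 0 < a) (ha1 : a ≤ 1) {z : ℂ}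
    (hza : ‖z‖ ≠ a) (hz1 : ‖z‖ ≠ 1) :
    ∃ A : ℂ →L[ℝ] ℂ, HasFDerivAt (radialStretch a K⁻¹) A z ∧ HasDistortion K A ∧ 1 ≤ ‖A‖ := by
  have hK0 : 0 < K := by linarith
  have hq : K⁻¹ - 1 ≤ 0 := sub_nonpos.2 (inv_le_one_of_one_le₀ hK)
  rcases lt_or_gt_of_ne hza with h | h
  · refine ⟨a ^ (K⁻¹ - 1) • ContinuousLinearMap.id ℝ ℂ, ?_, (hasDistortion_id hK).smul _, ?_⟩
    · have := (hasFDerivAt_id (𝕜 := ℝ) z).const_smul (a ^ (K⁻¹ - 1))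
      refine this.congr_of_eventuallyEq ?_
      filter_upwards [continuous_norm.continuousAt.eventually_lt_const h] with w hw
      exact radialStretch_of_norm_le ha1 hw.le
    · rw [norm_smul, ContinuousLinearMap.norm_id, mul_one, Real.norm_of_nonneg (by positivity)]
      exact Real.one_le_rpow_of_pos_of_le_one_of_nonpos ha ha1 hq
  rcases lt_or_gt_of_ne hz1 with h1 | h1
  · have h0 : 0 < ‖z‖ := ha.trans h
    have he : ‖(‖z‖⁻¹ • z)‖ = 1 := by
      rw [norm_smul, norm_inv, norm_norm, inv_mul_cancel₀ h0.ne']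
    refine ⟨_, ?_, (hasDistortion_radialScaling he hK).smul (‖z‖ ^ (K⁻¹ - 1)), ?_⟩
    · refine (hasFDerivAt_norm_rpow_smul K⁻¹ (norm_pos_iff.1 h0)).congr_of_eventuallyEq ?_
      filter_upwards [continuous_norm.continuousAt.eventually_lt_const h1,
        continuous_norm.continuousAt.eventually_const_lt h] with w hw hw'
      exact radialStretch_of_mem_annulus hw'.le hw.le
    · rw [norm_smul, Real.norm_of_nonneg (by positivity)]
      exact one_le_mul_of_one_le_of_one_le
        (Real.one_le_rpow_of_pos_of_le_one_of_nonpos h0 h1.le hq) (one_le_norm_radialScaling he _)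
  · refine ⟨_, ?_, hasDistortion_id hK, by simp⟩
    refine (hasFDerivAt_id z).congr_of_eventuallyEq ?_
    filter_upwards [continuous_norm.continuousAt.eventually_const_lt h1] with w hw
    exact radialStretch_of_one_le ha1 hw.le

end radialStretch

/-! ### The radial stretch of a general disc -/

/-- The radial stretch conjugated to the disc of centre `c` and radius `s`. -/
noncomputable def discStretchFun (c : ℂ) (s a q : ℝ) (z : ℂ) : ℂ :=
  c + s • radialStretch a q (s⁻¹ • (z - c))

theorem discStretchFun_discStretchFun {c : ℂ} {s a q : ℝ} (hs : 0 < s) (ha : 0 < a) (ha1 : a ≤ 1)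
    (hq : 0 < q) (z : ℂ) :
    discStretchFun c s (a ^ q) q⁻¹ (discStretchFun c s a q z) = z := by
  simp only [discStretchFun, add_sub_cancel_left]
  rw [inv_smul_smul₀ hs.ne', radialStretch_radialStretch ha ha1 hq, smul_inv_smul₀ hs.ne']
  ring

theorem continuous_discStretchFun {c : ℂ} {s a q : ℝ} (ha : 0 < a) :
    Continuous (discStretchFun c s a q) := by
  have := continuous_radialStretch (q := q) ha
  unfold discStretchFun
  fun_prop

/-- The radial stretch of a disc as a homeomorphism of the plane. -/
noncomputable def discStretch (c : ℂ) {s a q : ℝ} (hs : 0 < s) (ha : 0 < a) (ha1 : a ≤ 1)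
    (hq : 0 < q) : ℂ ≃ₜ ℂ where
  toFun := discStretchFun c s a q
  invFun := discStretchFun c s (a ^ q) q⁻¹
  left_inv := discStretchFun_discStretchFun hs ha ha1 hq
  right_inv z := by
    have h := discStretchFun_discStretchFun (c := c) hs (Real.rpow_pos_of_pos ha q)
      (Real.rpow_le_one ha.le ha1 hq.le) (inv_pos.2 hq) z
    rwa [← Real.rpow_mul ha.le, mul_inv_cancel₀ hq.ne', Real.rpow_one, inv_inv] at h
  continuous_toFun := continuous_discStretchFun ha
  continuous_invFun := continuous_discStretchFun (Real.rpow_pos_of_pos ha q)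

section discStretch

variable {c : ℂ} {s a q : ℝ}

theorem norm_inv_smul_sub (hs : 0 < s) (z : ℂ) : ‖s⁻¹ • (z - c)‖ = dist z c / s := by
  rw [norm_smul, norm_inv, Real.norm_of_nonneg hs.le, dist_eq_norm]
  ring

theorem discStretchFun_of_le_dist (hs : 0 < s) (ha1 : a ≤ 1) {z : ℂ} (hz : s ≤ dist z c) :
    discStretchFun c s a q z = z := by
  rw [discStretchFun, radialStretch_of_one_le ha1, smul_inv_smul₀ hs.ne']
  · ring
  · rwa [norm_inv_smul_sub hs, one_le_div hs]

theorem discStretchFun_of_dist_le (hs : 0 < s) (ha1 : a ≤ 1) {z : ℂ} (hz : dist z c ≤ a * s) :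
    discStretchFun c s a q z = c + a ^ (q - 1) • (z - c) := by
  rw [discStretchFun, radialStretch_of_norm_le ha1, smul_comm, smul_inv_smul₀ hs.ne']
  rwa [norm_inv_smul_sub hs, div_le_iff₀ hs]

theorem discStretchFun_mem_closedBall (hs : 0 < s) (ha : 0 < a) (ha1 : a ≤ 1) (hq : 0 < q) {z : ℂ}
    (hz : z ∈ closedBall c s) : discStretchFun c s a q z ∈ closedBall c s := by
  rw [mem_closedBall, discStretchFun, dist_eq_norm, add_sub_cancel_left, norm_smul,
    Real.norm_of_nonneg hs.le]
  have : ‖radialStretch a q (s⁻¹ • (z - c))‖ ≤ 1 := by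
    apply norm_radialStretch_le_one ha ha1 hq
    rw [norm_inv_smul_sub hs]
    exact div_le_one_of_le₀ hz hs.le
  nlinarith

theorem exists_lipschitzWith_discStretchFun (ha : 0 < a) (ha1 : a ≤ 1) :
    ∃ C, LipschitzWith C (discStretchFun c s a q) := by
  obtain ⟨C, hC⟩ := exists_lipschitzWith_radialStretch (q := q) ha ha1
  have h1 : LipschitzWith (1 * ‖s⁻¹‖₊) (fun z : ℂ ↦ s⁻¹ • (z - c)) := by
    rw [mul_comm]
    exact (lipschitzWith_smul s⁻¹).comp
      (LipschitzWith.of_dist_le_mul fun x y ↦ by simp)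
  have h2 := (lipschitzWith_smul (β := ℂ) s).comp (hC.comp h1)
  refine ⟨_, LipschitzWith.of_dist_le_mul (K := ‖s‖₊ * (C * (1 * ‖s⁻¹‖₊))) fun x y ↦ ?_⟩
  have := h2.dist_le_mul x y
  simpa [discStretchFun] using this

theorem discStretchFun_differential {K : ℝ} (hK : 1 ≤ K) (hs : 0 < s) (ha : 0 < a) (ha1 : a ≤ 1)
    {z : ℂ} (hza : dist z c ≠ a * s) (hz1 : dist z c ≠ s) :
    ∃ A : ℂ →L[ℝ] ℂ, HasFDerivAt (discStretchFun c s a K⁻¹) A z ∧ HasDistortion K A ∧ 1 ≤ ‖A‖ := by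
  have hn := norm_inv_smul_sub (c := c) hs z
  obtain ⟨A, hA, hD, h1⟩ := radialStretch_differential (z := s⁻¹ • (z - c)) hK ha ha1
    (by rw [hn, Ne, div_eq_iff hs.ne']; exact hza) (by rw [hn, Ne, div_eq_iff hs.ne', one_mul]; exact hz1)
  refine ⟨A, ?_, hD, h1⟩
  have h2 : HasFDerivAt (fun z : ℂ ↦ s⁻¹ • (z - c)) (s⁻¹ • ContinuousLinearMap.id ℝ ℂ) z :=
    ((hasFDerivAt_id z).sub_const c).const_smul s⁻¹
  have h3 := ((hA.comp z h2).const_smul s).const_add c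
  refine HasFDerivAt.congr_fderiv (f' := _) h3 ?_
  ext1 v
  simp [hs.ne']

end discStretch

/-! ### Energy bounds and the Sobolev property of limits of Lipschitz maps. -/

theorem memL2Loc_of_continuous {f : ℂ → ℂ} (hf : Continuous f) : MemL2Loc f := by
  intro S hS
  have : IsFiniteMeasure (volume.restrict S) := ⟨by simpa using hS.measure_lt_top⟩
  obtain ⟨C, hC⟩ := hS.exists_bound_of_continuousOn hf.continuousOn
  exact MemLp.of_bound hf.aestronglyMeasurable C
    ((ae_restrict_iff' hS.measurableSet).2 (Eventually.of_forall hC))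

/-- The energy of an injective almost everywhere differentiable map of bounded distortion is
controlled by the area of the image. -/
theorem lintegral_enorm_fderiv_sq_le {K : ℝ} (hK : 0 ≤ K) {f : ℂ → ℂ}
    (hd : ∀ᵐ z, DifferentiableAt ℝ f z) (hinj : Function.Injective f)
    (hD : ∀ᵐ z, HasDistortion K (fderiv ℝ f z)) {S T : Set ℂ} (hS : MeasurableSet S)
    (hST : MapsTo f S T) :
    ∫⁻ z in S, ‖fderiv ℝ f z‖ₑ ^ (2 : ℝ) ≤ ENNReal.ofReal K * volume T := by
  -- The area formula requires a derivative at every point of the set, hence the passage to a subset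
  -- of full measure.
  set U := S ∩ {z | DifferentiableAt ℝ f z} with hU
  have hUm : MeasurableSet U := hS.inter (measurableSet_of_differentiableAt ℝ f)
  have hSU : U =ᵐ[volume] S := inter_ae_eq_left_of_ae_eq_univ (by
    rw [eventuallyEq_univ]; exact hd)
  rw [← setLIntegral_congr hSU]
  calc ∫⁻ z in U, ‖fderiv ℝ f z‖ₑ ^ (2 : ℝ)
      ≤ ∫⁻ z in U, ENNReal.ofReal K * ENNReal.ofReal |(fderiv ℝ f z).det| := by
        refine lintegral_mono_ae ?_
        filter_upwards [ae_restrict_of_ae hD] with z hz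
        rw [← ENNReal.ofReal_mul hK, abs_of_nonneg hz.det_nonneg, ← ofReal_norm,
          ENNReal.ofReal_rpow_of_nonneg (norm_nonneg _) (by norm_num)]
        refine ENNReal.ofReal_le_ofReal ?_
        exact_mod_cast hz.norm_sq_le
    _ = ENNReal.ofReal K * ∫⁻ z in U, ENNReal.ofReal |(fderiv ℝ f z).det| :=
        lintegral_const_mul' _ _ ENNReal.ofReal_ne_top
    _ = ENNReal.ofReal K * volume (f '' U) := by
        rw [lintegral_abs_det_fderiv_eq_addHaar_image volume hUm
          (fun x hx ↦ (DifferentiableAt.hasFDerivAt hx.2).hasFDerivWithinAt) hinj.injOn]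
    _ ≤ _ := by
        gcongr
        exact (image_mono inter_subset_left).trans hST.image_subset

/-- Lipschitz functions have their pointwise derivative as distributional derivative. -/
theorem LipschitzWith.integral_fderiv_smul_eq {L : NNReal} {f : ℂ → ℂ} (hf : LipschitzWith L f)
    {ψ : ℂ → ℝ} (hψ : ContDiff ℝ ∞ ψ) (hψc : HasCompactSupport ψ) (v : ℂ) :
    ∫ z, (fderiv ℝ ψ z v) • f z = -∫ z, ψ z • fderiv ℝ f z v := by
  have hψ1 : ContDiff ℝ 1 ψ := hψ.of_le (by exact_mod_cast le_top)
  obtain ⟨D, hD⟩ := hψ1.lipschitzWith_of_hasCompactSupport hψc one_ne_zero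
  have hdψ : Differentiable ℝ ψ := hψ1.differentiable one_ne_zero
  have hcont : Continuous fun z ↦ fderiv ℝ ψ z v :=
    (hψ1.continuous_fderiv one_ne_zero).clm_apply continuous_const
  have hsupp : HasCompactSupport fun z ↦ fderiv ℝ ψ z v :=
    (hψc.fderiv_apply ℝ v)
  have hi1 : Integrable fun z ↦ (fderiv ℝ ψ z v) • f z :=
    (hcont.smul hf.continuous).integrable_of_hasCompactSupport hsupp.smul_right
  have hi2 : Integrable fun z ↦ ψ z • fderiv ℝ f z v := by
    refine Integrable.smul_of_top_left (φ := ψ)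
      (hψ1.continuous.integrable_of_hasCompactSupport (μ := volume) hψc) ?_
    refine memLp_top_of_bound (measurable_fderiv_apply_const ℝ f v).aestronglyMeasurable
      (L * ‖v‖) (Eventually.of_forall fun z ↦ ?_)
    exact ((fderiv ℝ f z).le_opNorm v).trans (by gcongr; exact norm_fderiv_le_of_lipschitz ℝ hf)
  -- Integration by parts is applied to scalar Lipschitz functions, so the identity is tested on the
  -- real and imaginary parts.
  have key (l : ℂ →L[ℝ] ℝ) :
      l (∫ z, (fderiv ℝ ψ z v) • f z) = l (-∫ z, ψ z • fderiv ℝ f z v) := by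
    rw [map_neg, ← l.integral_comp_comm hi1, ← l.integral_comp_comm hi2]
    have hlf : LipschitzWith (‖l‖₊ * L) (fun z ↦ l (f z)) := l.lipschitz.comp hf
    have h := hlf.integral_lineDeriv_mul_eq (μ := volume) hD hψc v
    have e1 : ∫ z, lineDeriv ℝ (fun z ↦ l (f z)) z v * ψ z = ∫ z, l (ψ z • fderiv ℝ f z v) := by
      refine integral_congr_ae ?_
      filter_upwards [hf.ae_differentiableAt] with z hz
      have : HasFDerivAt (fun z ↦ l (f z)) (l.comp (fderiv ℝ f z)) z :=
        l.hasFDerivAt.comp z hz.hasFDerivAt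
      rw [(this.hasLineDerivAt v).lineDeriv]
      rw [map_smul, smul_eq_mul, mul_comm]
      rfl
    have e2 : ∫ z, lineDeriv ℝ ψ z (-v) * l (f z) = -∫ z, l ((fderiv ℝ ψ z v) • f z) := by
      rw [← integral_neg]
      refine integral_congr_ae (Eventually.of_forall fun z ↦ ?_)
      simp only [(hdψ z).lineDeriv_eq_fderiv, map_neg, map_smul, smul_eq_mul]
      ring
    rw [← e1, h, e2, neg_neg]
  exact Complex.ext (key Complex.reCLM) (key Complex.imCLM)

/-- A homeomorphism which, near almost every point, is eventually equal to a member of a sequence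
of injective Lipschitz maps of distortion `K` at bounded distance from the identity and with
increasing norms of differentials, is `K`-quasiconformal. -/
theorem isQuasiconformal_of_eventuallyEq {K : ℝ} (hK : 0 ≤ K) (φ : ℂ ≃ₜ ℂ) (f : ℕ → ℂ → ℂ) (C : ℝ)
    (hlip : ∀ n, ∃ L, LipschitzWith L (f n)) (hinj : ∀ n, Function.Injective (f n))
    (hC : ∀ n z, ‖f n z - z‖ ≤ C)
    (hD : ∀ n, ∀ᵐ z, HasDistortion K (fderiv ℝ (f n) z))
    (hmono : ∀ n, ∀ᵐ z, ‖fderiv ℝ (f n) z‖ ≤ ‖fderiv ℝ (f (n + 1)) z‖)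
    (hev : ∀ᵐ z, ∃ N, ∀ n ≥ N, f n =ᶠ[𝓝 z] φ) : IsQuasiconformal K φ := by
  have hfd : ∀ᵐ z, ∃ N, ∀ n ≥ N, fderiv ℝ (f n) z = fderiv ℝ φ z := by
    filter_upwards [hev] with z ⟨N, hN⟩
    exact ⟨N, fun n hn ↦ (hN n hn).fderiv_eq⟩
  have htend : ∀ᵐ z, Tendsto (fun n ↦ fderiv ℝ (f n) z) atTop (𝓝 (fderiv ℝ φ z)) := by
    filter_upwards [hfd] with z ⟨N, hN⟩
    exact tendsto_const_nhds.congr' ((eventually_ge_atTop N).mono fun n hn ↦ (hN n hn).symm)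
  have hDall : ∀ᵐ z, HasDistortion K (fderiv ℝ φ z) := by
    filter_upwards [hfd, ae_all_iff.2 hD] with z ⟨N, hN⟩ h
    rw [← hN N le_rfl]
    exact h N
  -- The norms increase and are eventually equal to that of the limit, which is thus a dominating
  -- function.
  have hdom : ∀ᵐ z, ∀ n, ‖fderiv ℝ (f n) z‖ ≤ ‖fderiv ℝ φ z‖ := by
    filter_upwards [hfd, ae_all_iff.2 hmono] with z ⟨N, hN⟩ h n
    have hm : Monotone fun n ↦ ‖fderiv ℝ (f n) z‖ := monotone_nat_of_le_succ h
    rw [← hN (max N n) (le_max_left _ _)]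
    exact hm (le_max_right _ _)
  have hL2 : MemL2Loc (fun z ↦ fderiv ℝ φ z) := by
    intro S hS
    obtain ⟨ρ, hρ⟩ := hS.isBounded.subset_closedBall 0
    refine ⟨(measurable_fderiv ℝ φ).aestronglyMeasurable, ?_⟩
    -- The maps move points by at most `C`, so all the images of `S` lie in one ball; its area
    -- bounds every energy, and Fatou's lemma transfers the bound to the limit.
    set B := ENNReal.ofReal K * volume (closedBall (0 : ℂ) (ρ + C))
    have hB : B < ⊤ := ENNReal.mul_lt_top ENNReal.ofReal_lt_top measure_closedBall_lt_top
    have hbd (n : ℕ) : eLpNorm (fun z ↦ fderiv ℝ (f n) z) 2 (volume.restrict S) ≤ B ^ (1 / 2 : ℝ) := by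
      rw [eLpNorm_eq_lintegral_rpow_enorm_toReal two_ne_zero ENNReal.ofNat_ne_top]
      simp only [ENNReal.toReal_ofNat]
      gcongr
      obtain ⟨L, hL⟩ := hlip n
      refine lintegral_enorm_fderiv_sq_le hK hL.ae_differentiableAt (hinj n) (hD n)
        hS.measurableSet fun z hz ↦ ?_
      have h1 := hρ hz
      rw [mem_closedBall_zero_iff] at h1 ⊢
      calc ‖f n z‖ = ‖z + (f n z - z)‖ := by congr 1; ring
        _ ≤ ‖z‖ + ‖f n z - z‖ := norm_add_le _ _
        _ ≤ _ := add_le_add h1 (hC n z)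
    refine (Lp.eLpNorm_lim_le_liminf_eLpNorm
      (fun n ↦ (measurable_fderiv ℝ (f n)).aestronglyMeasurable) _
      (ae_restrict_of_ae htend)).trans_lt ?_
    refine (liminf_le_of_le (by isBoundedDefault) (a := B ^ (1 / 2 : ℝ)) fun b hb ↦ ?_).trans_lt
      (ENNReal.rpow_lt_top_of_nonneg (by norm_num) hB.ne)
    obtain ⟨n, hn⟩ := hb.exists
    exact hn.trans (hbd n)
  refine ⟨fun z ↦ fderiv ℝ φ z, ⟨memL2Loc_of_continuous φ.continuous, hL2, ?_⟩,
    hDall.mono fun z h ↦ h.det_nonneg, hDall.mono fun z h ↦ h.norm_apply_le⟩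
  intro ψ hψ hψc v
  have hψ1 : ContDiff ℝ 1 ψ := hψ.of_le (by exact_mod_cast le_top)
  have hcont : Continuous fun z ↦ fderiv ℝ ψ z v :=
    (hψ1.continuous_fderiv one_ne_zero).clm_apply continuous_const
  have hsupp : HasCompactSupport fun z ↦ fderiv ℝ ψ z v := hψc.fderiv_apply ℝ v
  have h1 : Tendsto (fun n ↦ ∫ z, (fderiv ℝ ψ z v) • f n z) atTop
      (𝓝 (∫ z, (fderiv ℝ ψ z v) • φ z)) := by
    refine tendsto_integral_of_dominated_convergence
      (fun z ↦ ‖fderiv ℝ ψ z v‖ * (‖z‖ + C)) (fun n ↦ ?_) ?_ (fun n ↦ ?_) ?_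
    · obtain ⟨L, hL⟩ := hlip n
      exact (hcont.smul hL.continuous).aestronglyMeasurable
    · exact Continuous.integrable_of_hasCompactSupport (by fun_prop) hsupp.norm.mul_right
    · refine Eventually.of_forall fun z ↦ ?_
      rw [norm_smul]
      gcongr
      calc ‖f n z‖ = ‖z + (f n z - z)‖ := by congr 1; ring
        _ ≤ ‖z‖ + ‖f n z - z‖ := norm_add_le _ _
        _ ≤ _ := by gcongr; exact hC n z
    · filter_upwards [hev] with z ⟨N, hN⟩
      exact tendsto_const_nhds.congr' ((eventually_ge_atTop N).mono fun n hn ↦ by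
        simp only; rw [(hN n hn).eq_of_nhds])
  have h2 : Tendsto (fun n ↦ ∫ z, ψ z • fderiv ℝ (f n) z v) atTop
      (𝓝 (∫ z, ψ z • fderiv ℝ φ z v)) := by
    refine tendsto_integral_of_dominated_convergence
      (fun z ↦ ‖ψ z‖ * (‖fderiv ℝ φ z‖ * ‖v‖)) (fun n ↦ ?_) ?_ (fun n ↦ ?_) ?_
    · exact hψ.continuous.aestronglyMeasurable.smul
        (measurable_fderiv_apply_const ℝ (f n) v).aestronglyMeasurable
    · have hcpt : IsCompact (tsupport ψ) := hψc
      rw [← integrableOn_iff_integrable_of_support_subset (s := tsupport ψ)]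
      · have : IsFiniteMeasure (volume.restrict (tsupport ψ)) :=
          ⟨by simpa using hcpt.measure_lt_top⟩
        have hi : Integrable (fun z ↦ ‖fderiv ℝ φ z‖ * ‖v‖) (volume.restrict (tsupport ψ)) :=
          ((hL2 _ hcpt).integrable one_le_two).norm.mul_const _
        obtain ⟨M, hM⟩ := hψ.continuous.bounded_above_of_compact_support hψc
        refine hi.bdd_mul (c := M) hψ.continuous.norm.aestronglyMeasurable
          (Eventually.of_forall fun z ↦ ?_)
        simpa using hM z
      · intro z hz
        refine subset_tsupport _ fun h ↦ hz ?_
        simp [h]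
    · filter_upwards [hdom] with z hz
      rw [norm_smul]
      gcongr
      exact ((fderiv ℝ (f n) z).le_opNorm v).trans (by gcongr; exact hz n)
    · filter_upwards [htend] with z hz
      exact ((ContinuousLinearMap.apply ℝ ℂ v).continuous.tendsto _ |>.comp hz).const_smul (ψ z)
  -- Both sides of the integration by parts formula pass to the limit by dominated convergence.
  refine tendsto_nhds_unique h1 (h2.neg.congr fun n ↦ ?_)
  obtain ⟨L, hL⟩ := hlip n
  exact (hL.integral_fderiv_smul_eq hψ hψc v).symm

/-! ### Areas and disc packings. -/

theorem volume_real_closedBall (c : ℂ) {r : ℝ} (hr : 0 ≤ r) :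
    volume.real (closedBall c r) = Real.pi * r ^ 2 := by
  rw [measureReal_def, Complex.volume_closedBall, ENNReal.toReal_mul, ENNReal.toReal_pow,
    ENNReal.toReal_ofReal hr, mul_comm]
  rfl

/-- Pairwise disjoint discs inside a disc: comparison of areas. -/
theorem sum_sq_le_of_disjoint {ι : Type*} (s : Finset ι) (z : ι → ℂ) (r : ι → ℝ)
    (hr : ∀ i ∈ s, 0 ≤ r i)
    (hd : (s : Set ι).PairwiseDisjoint fun i ↦ closedBall (z i) (r i)) {c : ℂ} {ρ : ℝ} (hρ : 0 ≤ ρ)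
    (hsub : ∀ i ∈ s, closedBall (z i) (r i) ⊆ closedBall c ρ) :
    ∑ i ∈ s, r i ^ 2 ≤ ρ ^ 2 := by
  have h1 : volume.real (⋃ i ∈ s, closedBall (z i) (r i)) = ∑ i ∈ s, Real.pi * r i ^ 2 := by
    rw [measureReal_biUnion_finset hd (fun i _ ↦ measurableSet_closedBall)
      (fun i _ ↦ measure_closedBall_lt_top.ne)]
    exact Finset.sum_congr rfl fun i hi ↦ volume_real_closedBall _ (hr i hi)
  have h2 := measureReal_mono (μ := volume) (iUnion₂_subset hsub) measure_closedBall_lt_top.ne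
  rw [h1, volume_real_closedBall _ hρ, ← Finset.mul_sum] at h2
  exact le_of_mul_le_mul_left h2 Real.pi_pos

/-- The unit disc can be filled up to an arbitrarily small area by finitely many disjoint discs of
arbitrarily small radii. -/
theorem exists_disc_packing {δ η : ℝ} (hδ : 0 < δ) (hη : η < 1) :
    ∃ (n : ℕ) (z : Fin n → ℂ) (r : Fin n → ℝ), (∀ i, 0 < r i) ∧ (∀ i, r i ≤ δ) ∧
      (∀ i, ‖z i‖ + r i ≤ 1) ∧ Pairwise (fun i j ↦ Disjoint (closedBall (z i) (r i))
        (closedBall (z j) (r j))) ∧ η ≤ ∑ i, r i ^ 2 := by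
  -- Besicovitch's theorem covers almost all of the disc by disjoint balls; the radius bound `1 -
  -- ‖x‖` keeps them inside. A finite subfamily then retains area above `π η`.
  obtain ⟨t, r, htc, hts, hr, hcov, hdisj⟩ := Besicovitch.exists_disjoint_closedBall_covering_ae
    (volume : Measure ℂ) (fun _ ↦ univ) (ball 0 1)
    (fun x _ ε hε ↦ by simpa using hε) (fun x ↦ min δ (1 - ‖x‖)) (fun x hx ↦ by
      rw [mem_ball_zero_iff] at hx
      exact lt_min hδ (by linarith))
  have hr0 : ∀ x ∈ t, 0 < r x := fun x hx ↦ (hr x hx).2.1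
  have hr1 : ∀ x ∈ t, r x < δ := fun x hx ↦ (hr x hx).2.2.trans_le (min_le_left _ _)
  have hr2 : ∀ x ∈ t, ‖x‖ + r x < 1 := fun x hx ↦ by
    have := (hr x hx).2.2.trans_le (min_le_right _ _)
    linarith
  have : Countable t := htc
  have hvol : volume (ball (0 : ℂ) 1) ≤ ∑' x : t, volume (closedBall (x : ℂ) (r x)) := by
    rw [← measure_biUnion htc hdisj fun _ _ ↦ measurableSet_closedBall]
    have h := measure_sdiff_add_inter (μ := volume) (ball (0 : ℂ) 1)
      (MeasurableSet.biUnion (f := fun x ↦ closedBall x (r x)) htc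
        fun _ _ ↦ measurableSet_closedBall)
    rw [hcov, zero_add] at h
    rw [← h]
    exact measure_mono inter_subset_right
  have hlt : ENNReal.ofReal (Real.pi * η) < ∑' x : t, volume (closedBall (x : ℂ) (r x)) := by
    refine lt_of_lt_of_le ?_ hvol
    rw [Complex.volume_ball]
    have : ENNReal.ofReal 1 ^ 2 * (NNReal.pi : ENNReal) = ENNReal.ofReal Real.pi := by
      rw [ENNReal.ofReal_one, one_pow, one_mul, ← NNReal.coe_real_pi, ENNReal.ofReal_coe_nnreal]
    rw [this, ENNReal.ofReal_lt_ofReal_iff Real.pi_pos]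
    nlinarith [Real.pi_pos]
  rw [ENNReal.tsum_eq_iSup_sum, lt_iSup_iff] at hlt
  obtain ⟨s, hs⟩ := hlt
  have e := s.equivFin.symm
  refine ⟨s.card, fun i ↦ ((e i : t) : ℂ), fun i ↦ r (e i : t), fun i ↦ hr0 _ (e i : t).2,
    fun i ↦ (hr1 _ (e i : t).2).le, fun i ↦ (hr2 _ (e i : t).2).le, fun i j hij ↦ ?_, ?_⟩
  · refine hdisj (e i : t).2 (e j : t).2 fun h ↦ hij ?_
    exact e.injective (Subtype.ext (Subtype.ext h))
  · have h1 : ∑ x ∈ s, volume (closedBall (x : ℂ) (r x))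
        = ENNReal.ofReal (∑ x ∈ s, Real.pi * r x ^ 2) := by
      rw [ENNReal.ofReal_sum_of_nonneg fun i _ ↦ by positivity]
      refine Finset.sum_congr rfl fun x _ ↦ ?_
      rw [← volume_real_closedBall _ (hr0 x x.2).le, ofReal_measureReal measure_closedBall_lt_top.ne]
    rw [h1] at hs
    have h2 := (ENNReal.ofReal_lt_ofReal_iff'.1 hs).1.le
    rw [← Finset.mul_sum] at h2
    refine (le_of_mul_le_mul_left h2 Real.pi_pos).trans_eq ?_
    rw [← Finset.sum_coe_sort s]
    exact (Equiv.sum_comp e fun x ↦ r ((x : t) : ℂ) ^ 2).symm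

/-! ### Cantor sets coded by sequences of letters -/

section Coding

variable {k : ℕ → ℕ}

/-- The product of the first `n` contraction ratios along a sequence of letters. -/
noncomputable def codeScale (q : ∀ n, Fin (k n) → ℝ) (x : ∀ n, Fin (k n)) (n : ℕ) : ℝ :=
  ∏ j ∈ Finset.range n, q j (x j)

/-- The centre of the disc of generation `n` along a sequence of letters. -/
noncomputable def codeCenter (z : ∀ n, Fin (k n) → ℂ) (q : ∀ n, Fin (k n) → ℝ)
    (x : ∀ n, Fin (k n)) (n : ℕ) : ℂ :=
  ∑ j ∈ Finset.range n, codeScale q x j • z j (x j)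

/-- The point coded by a sequence of letters. -/
noncomputable def codeLimit (z : ∀ n, Fin (k n) → ℂ) (q : ∀ n, Fin (k n) → ℝ)
    (x : ∀ n, Fin (k n)) : ℂ :=
  limUnder atTop (codeCenter z q x)

/-- The discs with centres `z n i` and radii `q n i` lie in the closed unit disc, and
`0 < q n i ≤ 1 / 2`. -/
structure IsDiscCode (z : ∀ n, Fin (k n) → ℂ) (q : ∀ n, Fin (k n) → ℝ) : Prop where
  pos : ∀ n i, 0 < q n i
  le_half : ∀ n i, q n i ≤ 1 / 2
  norm_add_le : ∀ n i, ‖z n i‖ + q n i ≤ 1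

variable {z : ∀ n, Fin (k n) → ℂ} {q : ∀ n, Fin (k n) → ℝ}

theorem codeScale_succ (x : ∀ n, Fin (k n)) (n : ℕ) :
    codeScale q x (n + 1) = codeScale q x n * q n (x n) :=
  Finset.prod_range_succ _ _

theorem codeCenter_succ (x : ∀ n, Fin (k n)) (n : ℕ) :
    codeCenter z q x (n + 1) = codeCenter z q x n + codeScale q x n • z n (x n) :=
  Finset.sum_range_succ _ _

theorem codeScale_congr {x y : ∀ n, Fin (k n)} {n : ℕ} (h : ∀ j < n, x j = y j) :
    codeScale q x n = codeScale q y n :=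
  Finset.prod_congr rfl fun j hj ↦ by rw [h j (Finset.mem_range.1 hj)]

theorem codeCenter_congr {x y : ∀ n, Fin (k n)} {n : ℕ} (h : ∀ j < n, x j = y j) :
    codeCenter z q x n = codeCenter z q y n :=
  Finset.sum_congr rfl fun j hj ↦ by
    have hj := Finset.mem_range.1 hj
    rw [h j hj, codeScale_congr fun i hi ↦ h i (hi.trans hj)]

namespace IsDiscCode

theorem scale_pos (h : IsDiscCode z q) (x : ∀ n, Fin (k n)) (n : ℕ) : 0 < codeScale q x n :=
  Finset.prod_pos fun j _ ↦ h.pos j _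

theorem scale_le (h : IsDiscCode z q) (x : ∀ n, Fin (k n)) (n : ℕ) : codeScale q x n ≤ (1 / 2) ^ n := by
  refine (Finset.prod_le_prod (fun j _ ↦ (h.pos j _).le) fun j _ ↦ h.le_half j _).trans_eq ?_
  simp

/-- Since `‖z‖ + q ≤ 1`, the step from generation `m` has length at most the drop in scale to
generation `m + 1`, and these drops telescope. -/
theorem dist_center_le (h : IsDiscCode z q) (x : ∀ n, Fin (k n)) {n m : ℕ} (hnm : n ≤ m) :
    dist (codeCenter z q x m) (codeCenter z q x n) ≤ codeScale q x n - codeScale q x m := by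
  induction m, hnm using Nat.le_induction with
  | base => simp
  | succ m hm ih =>
    have h1 : dist (codeCenter z q x (m + 1)) (codeCenter z q x m)
        = codeScale q x m * ‖z m (x m)‖ := by
      rw [codeCenter_succ, dist_eq_norm, add_sub_cancel_left, norm_smul,
        Real.norm_of_nonneg (h.scale_pos x m).le]
    have h2 := mul_le_mul_of_nonneg_left (h.norm_add_le m (x m)) (h.scale_pos x m).le
    have h3 := dist_triangle (codeCenter z q x (m + 1)) (codeCenter z q x m) (codeCenter z q x n)
    rw [codeScale_succ]
    linarith

theorem tendsto_codeCenter (h : IsDiscCode z q) (x : ∀ n, Fin (k n)) :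
    Tendsto (codeCenter z q x) atTop (𝓝 (codeLimit z q x)) := by
  refine CauchySeq.tendsto_limUnder (cauchySeq_of_le_geometric (1 / 2 : ℝ) 1 (by norm_num)
    fun n ↦ ?_)
  rw [dist_comm, one_mul]
  have := h.dist_center_le x n.le_succ
  linarith [h.scale_le x n, h.scale_pos x (n + 1)]

theorem dist_limit_center_le (h : IsDiscCode z q) (x : ∀ n, Fin (k n)) (n : ℕ) :
    dist (codeLimit z q x) (codeCenter z q x n) ≤ codeScale q x n := by
  refine le_of_tendsto ((h.tendsto_codeCenter x).dist tendsto_const_nhds)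
    ((eventually_ge_atTop n).mono fun m hm ↦ (h.dist_center_le x hm).trans ?_)
  linarith [h.scale_pos x m]

/-- The centres converge uniformly, and each depends on finitely many discrete letters. Compactness
of the Cantor set follows from that of the product space. -/
theorem continuous_codeLimit (h : IsDiscCode z q) : Continuous (codeLimit z q) := by
  have hu : TendstoUniformly (fun n x ↦ codeCenter z q x n) (codeLimit z q) atTop := by
    rw [Metric.tendstoUniformly_iff]
    intro ε hε
    filter_upwards [(tendsto_pow_atTop_nhds_zero_of_lt_one (by norm_num : (0 : ℝ) ≤ 1 / 2)
      (by norm_num)).eventually_lt_const hε] with n hn x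
    exact ((h.dist_limit_center_le x n).trans (h.scale_le x n)).trans_lt hn
  refine hu.continuous (Eventually.of_forall fun n ↦ ?_).frequently
  have hs (m : ℕ) : Continuous fun x ↦ codeScale q x m :=
    continuous_finsetProd _ fun j _ ↦
      (continuous_of_discreteTopology (f := q j)).comp (continuous_apply j)
  exact continuous_finsetSum _ fun j _ ↦ (hs j).smul
    ((continuous_of_discreteTopology (f := z j)).comp (continuous_apply j))

theorem isCompact_range (h : IsDiscCode z q) : IsCompact (range (codeLimit z q)) :=
  _root_.isCompact_range h.continuous_codeLimit

/-- Upper bound for the Hausdorff measure of a coded Cantor set. -/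
theorem hausdorffMeasure_range_lt_top (h : IsDiscCode z q) {d : ℝ} (hd : 0 < d) {C : ℝ}
    (hC : ∀ n, ∏ j ∈ Finset.range n, ∑ i, q j i ^ d ≤ C) :
    μH[d] (range (codeLimit z q)) < ⊤ := by
  have hr : Tendsto (fun n : ℕ ↦ ENNReal.ofReal (2 * (1 / 2) ^ n)) atTop (𝓝 0) := by
    have h1 := (tendsto_pow_atTop_nhds_zero_of_lt_one (by norm_num : (0 : ℝ) ≤ 1 / 2)
      (by norm_num)).const_mul 2
    simpa using ENNReal.tendsto_ofReal h1
  -- The covering sets are the images of the cylinders of length `n`.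
  let t : ∀ n : ℕ, (∀ j : Fin n, Fin (k j)) → Set ℂ := fun n w ↦
    codeLimit z q '' {x | ∀ j : Fin n, x j = w j}
  have hdiam (n : ℕ) (w : ∀ j : Fin n, Fin (k j)) :
      ediam (t n w) ≤ 2 * ∏ j : Fin n, ENNReal.ofReal (q j (w j)) := by
    refine ediam_le ?_
    rintro _ ⟨x, hx, rfl⟩ _ ⟨y, hy, rfl⟩
    have hxy : ∀ j < n, x j = y j := fun j hj ↦ (hx ⟨j, hj⟩).trans (hy ⟨j, hj⟩).symm
    have h1 : dist (codeLimit z q x) (codeLimit z q y) ≤ 2 * codeScale q x n := by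
      have h2 := h.dist_limit_center_le x n
      have h3 := h.dist_limit_center_le y n
      rw [← codeCenter_congr hxy, ← codeScale_congr hxy, dist_comm] at h3
      linarith [dist_triangle (codeLimit z q x) (codeCenter z q x n) (codeLimit z q y)]
    rw [edist_dist, ← ENNReal.ofReal_prod_of_nonneg fun j _ ↦ (h.pos _ _).le]
    calc ENNReal.ofReal (dist (codeLimit z q x) (codeLimit z q y))
        ≤ ENNReal.ofReal (2 * codeScale q x n) := ENNReal.ofReal_le_ofReal h1
      _ = 2 * ENNReal.ofReal (codeScale q x n) := by
        rw [ENNReal.ofReal_mul zero_le_two, ENNReal.ofReal_ofNat]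
      _ = _ := by
        rw [codeScale, ← Fin.prod_univ_eq_prod_range (fun j ↦ q j (x j))]
        congr 3 with j
        rw [hx j]
  refine (Measure.hausdorffMeasure_le_liminf_sum d (range (codeLimit z q)) _ hr t
    (Eventually.of_forall fun n w ↦ ?_) (Eventually.of_forall fun n ↦ ?_)).trans_lt ?_
  · refine (hdiam n w).trans ?_
    rw [ENNReal.ofReal_mul zero_le_two, ENNReal.ofReal_ofNat,
      ← ENNReal.ofReal_prod_of_nonneg fun j _ ↦ (h.pos _ _).le]
    gcongr
    refine (Finset.prod_le_prod (fun j _ ↦ (h.pos _ _).le) fun j _ ↦ h.le_half _ _).trans_eq ?_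
    simp
  · rintro _ ⟨x, rfl⟩
    exact mem_iUnion.2 ⟨fun j ↦ x j, x, fun j ↦ rfl, rfl⟩
  · have hb (n : ℕ) : ∑ w, ediam (t n w) ^ d ≤ 2 ^ d * ENNReal.ofReal C := by
      calc ∑ w, ediam (t n w) ^ d
          ≤ ∑ w : ∀ j : Fin n, Fin (k j), 2 ^ d * ∏ j : Fin n, ENNReal.ofReal (q j (w j) ^ d) := by
            refine Finset.sum_le_sum fun w _ ↦ ?_
            refine (ENNReal.rpow_le_rpow (hdiam n w) hd.le).trans_eq ?_
            rw [ENNReal.mul_rpow_of_nonneg _ _ hd.le, ← ENNReal.prod_rpow_of_nonneg hd.le]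
            congr 2 with j
            rw [ENNReal.ofReal_rpow_of_pos (h.pos _ _)]
        _ = 2 ^ d * ENNReal.ofReal (∏ j ∈ Finset.range n, ∑ i, q j i ^ d) := by
            rw [← Finset.mul_sum, ← Fin.prod_univ_eq_prod_range (fun j ↦ ∑ i, q j i ^ d),
              ENNReal.ofReal_prod_of_nonneg fun j _ ↦
                Finset.sum_nonneg fun i _ ↦ Real.rpow_nonneg (h.pos _ _).le _]
            congr 1
            -- Expanding the product of the sums over letters gives the sum over words.
            rw [← Fintype.piFinset_univ, ← Finset.prod_univ_sum (fun _ ↦ Finset.univ)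
              fun (j : Fin n) i ↦ ENNReal.ofReal (q j i ^ d)]
            refine Finset.prod_congr rfl fun j _ ↦ ?_
            rw [ENNReal.ofReal_sum_of_nonneg fun i _ ↦ Real.rpow_nonneg (h.pos _ _).le _]
        _ ≤ _ := by gcongr; exact hC n
    refine (liminf_le_of_le (by isBoundedDefault) (a := 2 ^ d * ENNReal.ofReal C)
      fun b hb' ↦ ?_).trans_lt (ENNReal.mul_lt_top (ENNReal.rpow_lt_top_of_nonneg hd.le
        ENNReal.ofNat_ne_top) ENNReal.ofReal_lt_top)
    obtain ⟨n, hn⟩ := hb'.exists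
    exact hn.trans (hb n)

end IsDiscCode

/-! ### The natural measure on a coded Cantor set and its Frostman estimate. -/

/-- The measure on a finite alphabet with given weights. -/
noncomputable def letterMeasure {n : ℕ} (p : Fin n → ℝ) : Measure (Fin n) :=
  ∑ i, ENNReal.ofReal (p i) • Measure.dirac i

theorem letterMeasure_coe {n : ℕ} {p : Fin n → ℝ} (hp : ∀ i, 0 ≤ p i) (s : Finset (Fin n)) :
    letterMeasure p s = ENNReal.ofReal (∑ i ∈ s, p i) := by
  classical
  rw [letterMeasure, Measure.finsetSum_apply, ENNReal.ofReal_sum_of_nonneg fun i _ ↦ hp i]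
  simp only [Measure.smul_apply, Measure.dirac_apply, smul_eq_mul]
  rw [← Finset.sum_filter_add_sum_filter_not Finset.univ (fun i ↦ i ∈ s)]
  rw [Finset.sum_eq_zero (s := Finset.univ.filter fun i ↦ i ∉ s), add_zero]
  · rw [Finset.filter_mem_eq_inter, Finset.univ_inter]
    refine Finset.sum_congr rfl fun i hi ↦ ?_
    simp [hi]
  · intro i hi
    simp [(Finset.mem_filter.1 hi).2]

theorem isProbabilityMeasure_letterMeasure {n : ℕ} {p : Fin n → ℝ} (hp : ∀ i, 0 ≤ p i)
    (h1 : ∑ i, p i = 1) : IsProbabilityMeasure (letterMeasure p) :=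
  ⟨by rw [← Finset.coe_univ, letterMeasure_coe hp, h1, ENNReal.ofReal_one]⟩

/-- Frostman estimate for the natural measure on a coded Cantor set: the letters are weighted by
the areas of pairwise disjoint discs of radii `r n i ≥ 2 q n i`. -/
theorem IsDiscCode.infinitePi_preimage_le (h : IsDiscCode z q) {d : ℝ} (hd : 0 < d) (hd2 : d ≤ 2)
    {r p : ∀ n, Fin (k n) → ℝ} (hqr : ∀ n i, 2 * q n i ≤ r n i)
    (hdisj : ∀ n, Pairwise fun i j ↦ Disjoint (closedBall (z n i) (r n i))
      (closedBall (z n j) (r n j)))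
    (hp : ∀ n i, 0 ≤ p n i) (hp1 : ∀ n, ∑ i, p n i = 1) (hpr : ∀ n i, p n i ≤ 2 * r n i ^ 2)
    (hpq : ∀ n i, p n i ≤ q n i ^ d) [∀ n, IsProbabilityMeasure (letterMeasure (p n))]
    (U : Set ℂ) :
    Measure.infinitePi (fun n ↦ letterMeasure (p n)) (codeLimit z q ⁻¹' U)
      ≤ 32 * ediam U ^ d := by
  classical
  set μ := Measure.infinitePi (fun n ↦ letterMeasure (p n)) with hμ
  set A := codeLimit z q ⁻¹' U with hA
  rcases A.eq_empty_or_nonempty with hAe | ⟨x₀, hx₀⟩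
  · simp [hAe]
  by_cases hU : ediam U = ⊤
  · rw [hU, ENNReal.top_rpow_of_pos hd, ENNReal.mul_top (by norm_num)]
    exact le_top
  set δ := (ediam U).toReal with hδ
  have hδU : ediam U = ENNReal.ofReal δ := (ENNReal.ofReal_toReal hU).symm
  have hδ0 : 0 ≤ δ := ENNReal.toReal_nonneg
  have hdist {w w' : ∀ n, Fin (k n)} (hw : w ∈ A) (hw' : w' ∈ A) :
      dist (codeLimit z q w) (codeLimit z q w') ≤ δ := by
    have : edist (codeLimit z q w) (codeLimit z q w') ≤ ediam U := edist_le_ediam_of_mem hw hw'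
    rw [edist_dist, hδU] at this
    exact (ENNReal.ofReal_le_ofReal_iff hδ0).1 this
  have hscale (x : ∀ n, Fin (k n)) (n : ℕ) :
      ∏ j ∈ Finset.range n, p j (x j) ≤ codeScale q x n ^ d := by
    rw [codeScale, ← Real.finsetProd_rpow _ _ fun j _ ↦ (h.pos _ _).le]
    exact Finset.prod_le_prod (fun j _ ↦ hp _ _) fun j _ ↦ hpq _ _
  -- The letters that occur at position `n` among the codes in `A`; the product of these sets
  -- contains `A`.
  let t : ∀ n, Finset (Fin (k n)) := fun n ↦ Finset.univ.filter fun i ↦ ∃ w ∈ A, w n = i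
  have hcyl (n : ℕ) : μ A ≤ ∏ j ∈ Finset.range n, ENNReal.ofReal (∑ i ∈ t j, p j i) := by
    have h1 : A ⊆ (Finset.range n : Set ℕ).pi fun j ↦ (t j : Set (Fin (k j))) := fun w hw j _ ↦ by
      simp only [t, Finset.coe_filter, Finset.mem_univ, true_and, mem_ofPred_eq]
      exact ⟨w, hw, rfl⟩
    refine (measure_mono h1).trans_eq ?_
    rw [hμ, Measure.infinitePi_pi _ fun j _ ↦ (t j).measurableSet]
    exact Finset.prod_congr rfl fun j _ ↦ letterMeasure_coe (hp j) _
  have hsingle {j : ℕ} (hj : ∀ y ∈ A, y j = x₀ j) : ∑ i ∈ t j, p j i = p j (x₀ j) := by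
    have : t j = {x₀ j} := by
      ext i
      simp only [t, Finset.mem_filter, Finset.mem_univ, true_and, Finset.mem_singleton]
      constructor
      · rintro ⟨w, hw, rfl⟩
        exact hj w hw
      · rintro rfl
        exact ⟨x₀, hx₀, rfl⟩
    rw [this, Finset.sum_singleton]
  have hcyl0 {n : ℕ} (hn : ∀ j < n, ∀ y ∈ A, y j = x₀ j) :
      ∏ j ∈ Finset.range n, ENNReal.ofReal (∑ i ∈ t j, p j i)
        ≤ ENNReal.ofReal (codeScale q x₀ n ^ d) := by
    rw [← ENNReal.ofReal_prod_of_nonneg fun j _ ↦ Finset.sum_nonneg fun i _ ↦ hp j i]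
    refine ENNReal.ofReal_le_ofReal ((Finset.prod_congr rfl fun j hj ↦ ?_).trans_le (hscale x₀ n))
    exact hsingle (hn j (Finset.mem_range.1 hj))
  -- If all codes in `A` agree everywhere, `A` lies in cylinders whose measures tend to 0. Otherwise
  -- the first position of disagreement determines the scale `ρ` at which areas are compared.
  by_cases hall : ∀ j, ∀ y ∈ A, y j = x₀ j
  · have h0 : μ A ≤ 0 := by
      have hlim : Tendsto (fun n : ℕ ↦ ENNReal.ofReal (((1 / 2 : ℝ) ^ n) ^ d)) atTop (𝓝 0) := by
        have h1 := (tendsto_pow_atTop_nhds_zero_of_lt_one (by norm_num : (0 : ℝ) ≤ 1 / 2)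
          (by norm_num)).rpow_const (p := d) (Or.inr hd.le)
        rw [Real.zero_rpow hd.ne'] at h1
        simpa using ENNReal.tendsto_ofReal h1
      refine ge_of_tendsto' hlim fun n ↦ (hcyl n).trans ((hcyl0 fun j _ ↦ hall j).trans ?_)
      exact ENNReal.ofReal_le_ofReal
        (Real.rpow_le_rpow (h.scale_pos _ _).le (h.scale_le _ _) hd.le)
    exact h0.trans zero_le
  push Not at hall
  have hn := Nat.find_spec hall
  have hmin : ∀ j < Nat.find hall, ∀ y ∈ A, y j = x₀ j := fun j hj y hy ↦ by
    by_contra hne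
    exact Nat.find_min hall hj ⟨y, hy, hne⟩
  set n := Nat.find hall
  obtain ⟨y, hy, hyn⟩ := hn
  set ρ := codeScale q x₀ n with hρ
  set c := codeCenter z q x₀ n with hc
  have hρ0 : 0 < ρ := h.scale_pos _ _
  have hloc {w : ∀ n, Fin (k n)} (hw : w ∈ A) :
      dist (codeLimit z q w) (c + ρ • z n (w n)) ≤ ρ * q n (w n) := by
    have := h.dist_limit_center_le w (n + 1)
    rw [codeCenter_succ, codeScale_succ, codeCenter_congr (y := x₀) fun j hj ↦ hmin j hj w hw,
      codeScale_congr (y := x₀) fun j hj ↦ hmin j hj w hw] at this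
    exact this
  have hsep (i j : Fin (k n)) : dist (c + ρ • z n i) (c + ρ • z n j) = ρ * dist (z n i) (z n j) := by
    rw [dist_add_left, dist_smul₀, Real.norm_of_nonneg hρ0.le]
  -- At least two letters occur at position `n`. Their discs of radii `ρ r` are disjoint while the
  -- coded points lie in the concentric half discs, so those points are at least `ρ r / 2` apart.
  have hrad : ∀ i ∈ t n, ρ * r n i ≤ 2 * δ := by
    intro i hi
    obtain ⟨w, hw, rfl⟩ := (Finset.mem_filter.1 hi).2
    obtain ⟨w', hw', hne⟩ : ∃ w' ∈ A, w' n ≠ w n := by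
      by_cases hx : x₀ n = w n
      · exact ⟨y, hy, by rw [← hx]; exact hyn⟩
      · exact ⟨x₀, hx₀, hx⟩
    have h1 := (disjoint_closedBall_closedBall_iff
      (by linarith [hqr n (w' n), h.pos n (w' n)]) (by linarith [hqr n (w n), h.pos n (w n)])).1
      (hdisj n hne)
    have h2 := hloc hw
    have h3 := hloc hw'
    have h4 := hdist hw' hw
    have h5 := hsep (w' n) (w n)
    have h6 := dist_triangle4 (c + ρ • z n (w' n)) (codeLimit z q w') (codeLimit z q w)
      (c + ρ • z n (w n))
    rw [dist_comm (c + ρ • z n (w' n)) (codeLimit z q w')] at h6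
    have h7 := mul_le_mul_of_nonneg_left h1.le hρ0.le
    have h8 := mul_le_mul_of_nonneg_left (hqr n (w n)) hρ0.le
    have h9 := mul_le_mul_of_nonneg_left (hqr n (w' n)) hρ0.le
    have h10 := mul_nonneg hρ0.le (h.pos n (w' n)).le
    linarith
  -- The discs fit in a ball of radius `4δ`: radius at most `2δ`, centre to coded point at most `δ`,
  -- coded point to that of `x₀` at most `δ`.
  have harea : ∑ i ∈ t n, (ρ * r n i) ^ 2 ≤ (4 * δ) ^ 2 := by
    refine sum_sq_le_of_disjoint (t n) (fun i ↦ c + ρ • z n i) _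
      (fun i _ ↦ mul_nonneg hρ0.le (by linarith [hqr n i, h.pos n i])) ?_ (c := codeLimit z q x₀)
      (by linarith) fun i hi ↦ ?_
    · intro i _ j _ hij
      have hri := hqr n i
      have hrj := hqr n j
      have hqi := h.pos n i
      have hqj := h.pos n j
      have h1 := (disjoint_closedBall_closedBall_iff (by linarith) (by linarith)).1
        (hdisj n hij)
      refine closedBall_disjoint_closedBall ?_
      rw [hsep]
      nlinarith
    · have h0 := hrad i hi
      obtain ⟨w, hw, rfl⟩ := (Finset.mem_filter.1 hi).2
      refine closedBall_subset_closedBall' ?_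
      have h2 := hloc hw
      rw [dist_comm] at h2
      have h3 := hdist hw hx₀
      have h4 := dist_triangle (c + ρ • z n (w n)) (codeLimit z q w) (codeLimit z q x₀)
      have h5 := mul_le_mul_of_nonneg_left (hqr n (w n)) hρ0.le
      linarith
  have hsum1 : ∑ i ∈ t n, p n i ≤ 1 := by
    rw [← hp1 n]
    exact Finset.sum_le_sum_of_subset_of_nonneg (Finset.subset_univ _) fun i _ _ ↦ hp n i
  have hsum2 : ρ ^ 2 * ∑ i ∈ t n, p n i ≤ 32 * δ ^ 2 := by
    calc ρ ^ 2 * ∑ i ∈ t n, p n i ≤ ρ ^ 2 * ∑ i ∈ t n, 2 * r n i ^ 2 := by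
          gcongr with i _
          exact hpr n i
      _ = 2 * ∑ i ∈ t n, (ρ * r n i) ^ 2 := by
          simp only [mul_pow, ← Finset.mul_sum]
          ring
      _ ≤ 32 * δ ^ 2 := by linarith
  -- For `ρ ≤ δ` total mass at most 1 suffices; for `δ ≤ ρ` the area bound `hsum2` is multiplied by
  -- `ρ ^ (d - 2) ≤ δ ^ (d - 2)`, using `d ≤ 2`.
  have hfin : ρ ^ d * ∑ i ∈ t n, p n i ≤ 32 * δ ^ d := by
    rcases le_total ρ δ with hle | hle
    · have := Real.rpow_le_rpow hρ0.le hle hd.le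
      have h0 := Real.rpow_nonneg hδ0 d
      have h0' := Real.rpow_nonneg hρ0.le d
      nlinarith
    · rcases hδ0.eq_or_lt with hz | hδp
      · rw [← hz] at hsum2 ⊢
        have : ∑ i ∈ t n, p n i ≤ 0 := by
          by_contra hcon
          have := mul_pos (pow_pos hρ0 2) (not_le.1 hcon)
          norm_num at hsum2
          linarith
        rw [Real.zero_rpow hd.ne']
        have h0' := Real.rpow_nonneg hρ0.le d
        nlinarith
      · have e1 : ρ ^ d = ρ ^ (2 : ℕ) * ρ ^ (d - 2) := by
          rw [← Real.rpow_natCast, ← Real.rpow_add hρ0]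
          norm_num
        have e2 : δ ^ d = δ ^ (2 : ℕ) * δ ^ (d - 2) := by
          rw [← Real.rpow_natCast, ← Real.rpow_add hδp]
          norm_num
        have h1 : ρ ^ (d - 2) ≤ δ ^ (d - 2) := Real.rpow_le_rpow_of_nonpos hδp hle (by linarith)
        rw [e1, e2]
        calc ρ ^ 2 * ρ ^ (d - 2) * ∑ i ∈ t n, p n i
            = (ρ ^ 2 * ∑ i ∈ t n, p n i) * ρ ^ (d - 2) := by ring
          _ ≤ (32 * δ ^ 2) * δ ^ (d - 2) := by gcongr
          _ = _ := by ring
  calc μ A ≤ ∏ j ∈ Finset.range (n + 1), ENNReal.ofReal (∑ i ∈ t j, p j i) := hcyl (n + 1)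
    _ ≤ ENNReal.ofReal (ρ ^ d) * ENNReal.ofReal (∑ i ∈ t n, p n i) := by
        rw [Finset.prod_range_succ]
        gcongr
        exact hcyl0 hmin
    _ = ENNReal.ofReal (ρ ^ d * ∑ i ∈ t n, p n i) := by
        rw [ENNReal.ofReal_mul (Real.rpow_nonneg hρ0.le d)]
    _ ≤ ENNReal.ofReal (32 * δ ^ d) := ENNReal.ofReal_le_ofReal hfin
    _ = 32 * ediam U ^ d := by
        rw [ENNReal.ofReal_mul (by norm_num), ENNReal.ofReal_ofNat, hδU,
          ENNReal.ofReal_rpow_of_nonneg hδ0 hd.le]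

/-- Lower bound for the Hausdorff measure of a coded Cantor set. -/
theorem IsDiscCode.hausdorffMeasure_range_pos (h : IsDiscCode z q) {d : ℝ} (hd : 0 < d)
    (hd2 : d ≤ 2) {r p : ∀ n, Fin (k n) → ℝ} (hqr : ∀ n i, 2 * q n i ≤ r n i)
    (hdisj : ∀ n, Pairwise fun i j ↦ Disjoint (closedBall (z n i) (r n i))
      (closedBall (z n j) (r n j)))
    (hp : ∀ n i, 0 ≤ p n i) (hp1 : ∀ n, ∑ i, p n i = 1) (hpr : ∀ n i, p n i ≤ 2 * r n i ^ 2)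
    (hpq : ∀ n i, p n i ≤ q n i ^ d) : 0 < μH[d] (range (codeLimit z q)) := by
  have (n : ℕ) : IsProbabilityMeasure (letterMeasure (p n)) :=
    isProbabilityMeasure_letterMeasure (hp n) (hp1 n)
  set μ := Measure.infinitePi (fun n ↦ letterMeasure (p n)) with hμ
  have hcont := h.continuous_codeLimit
  have hmeas : Measurable (codeLimit z q) := hcont.measurable
  have hle : (32⁻¹ : ENNReal) • μ.map (codeLimit z q) ≤ μH[d] := by
    refine Measure.le_hausdorffMeasure d _ 1 one_pos fun s _ ↦ ?_
    rw [Measure.smul_apply, smul_eq_mul]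
    -- Passing to the closure makes the set measurable without changing its diameter.
    calc 32⁻¹ * μ.map (codeLimit z q) s ≤ 32⁻¹ * μ.map (codeLimit z q) (closure s) := by
          gcongr
          exact subset_closure
      _ ≤ 32⁻¹ * (32 * ediam (closure s) ^ d) := by
          rw [Measure.map_apply hmeas isClosed_closure.measurableSet]
          gcongr
          exact h.infinitePi_preimage_le hd hd2 hqr hdisj hp hp1 hpr hpq _
      _ = ediam s ^ d := by
          rw [ediam_closure, ← mul_assoc, ENNReal.inv_mul_cancel (by norm_num) (by norm_num),
            one_mul]
  refine lt_of_lt_of_le ?_ (hle (range (codeLimit z q)))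
  rw [Measure.smul_apply, smul_eq_mul,
    Measure.map_apply hmeas h.isCompact_range.measurableSet, preimage_range, measure_univ, mul_one]
  exact ENNReal.inv_pos.2 (by norm_num)

end Coding

/-! ### Limits of homeomorphisms, packings, and stretches in discs. -/

/-- A sequence of homeomorphisms converging geometrically together with the inverses converges to a
homeomorphism. -/
theorem exists_homeomorph_of_dist_le {X : Type*} [MetricSpace X] [CompleteSpace X] (f : ℕ → X ≃ₜ X)
    (h : ∀ n x, dist (f n x) (f (n + 1) x) ≤ 2 * (1 / 2) ^ n)
    (h' : ∀ n x, dist ((f n).symm x) ((f (n + 1)).symm x) ≤ 2 * (1 / 2) ^ n) :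
    ∃ φ : X ≃ₜ X, ∀ n x, dist (f n x) (φ x) ≤ 4 * (1 / 2) ^ n := by
  have hpow : Tendsto (fun n : ℕ ↦ 4 * (1 / 2 : ℝ) ^ n) atTop (𝓝 0) := by
    simpa using (tendsto_pow_atTop_nhds_zero_of_lt_one (by norm_num : (0 : ℝ) ≤ 1 / 2)
      (by norm_num)).const_mul 4
  have key (g : ℕ → X ≃ₜ X) (hg : ∀ n x, dist (g n x) (g (n + 1) x) ≤ 2 * (1 / 2) ^ n) :
      ∃ γ : X → X, Continuous γ ∧ (∀ n x, dist (g n x) (γ x) ≤ 4 * (1 / 2) ^ n) := by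
    have hc (x : X) : ∃ y, Tendsto (fun n ↦ g n x) atTop (𝓝 y) :=
      cauchySeq_tendsto_of_complete
        (cauchySeq_of_le_geometric (1 / 2) 2 (by norm_num) fun n ↦ hg n x)
    choose γ hγ using hc
    have hb (n : ℕ) (x : X) : dist (g n x) (γ x) ≤ 4 * (1 / 2) ^ n := by
      have := dist_le_of_le_geometric_of_tendsto (1 / 2) 2 (by norm_num) (fun n ↦ hg n x) (hγ x) n
      exact this.trans_eq (by ring)
    refine ⟨γ, ?_, hb⟩
    have hu : TendstoUniformly (fun n x ↦ g n x) γ atTop := by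
      rw [Metric.tendstoUniformly_iff]
      intro ε hε
      filter_upwards [hpow.eventually_lt_const hε] with n hn x
      rw [dist_comm]
      exact (hb n x).trans_lt hn
    exact hu.continuous (Eventually.of_forall fun n ↦ (g n).continuous).frequently
  obtain ⟨φ, hφc, hφ⟩ := key f h
  obtain ⟨ψ, hψc, hψ⟩ := key (fun n ↦ (f n).symm) h'
  have hlim {γ : X → X} {g : ℕ → X → X} (hg : ∀ n x, dist (g n x) (γ x) ≤ 4 * (1 / 2) ^ n) (x : X) :
      Tendsto (fun n ↦ g n x) atTop (𝓝 (γ x)) := by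
    rw [tendsto_iff_dist_tendsto_zero]
    exact squeeze_zero (fun _ ↦ dist_nonneg) (fun n ↦ hg n x) hpow
  have hinv {γ δ : X → X} {g e : ℕ → X → X} (hγ : Continuous γ)
      (hg : ∀ n x, dist (g n x) (γ x) ≤ 4 * (1 / 2) ^ n)
      (he : ∀ n x, dist (e n x) (δ x) ≤ 4 * (1 / 2) ^ n) (hge : ∀ n x, g n (e n x) = x) (x : X) :
      γ (δ x) = x := by
    refine tendsto_nhds_unique ((hγ.tendsto _).comp (hlim he x)) ?_
    rw [tendsto_iff_dist_tendsto_zero]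
    -- The uniform estimate for `g n` is used at the moving point `e n x`, where `g n` takes the
    -- value `x`.
    refine squeeze_zero (fun _ ↦ dist_nonneg) (fun n ↦ ?_) hpow
    have := hg n (e n x)
    rwa [hge, dist_comm] at this
  exact ⟨⟨⟨φ, ψ, hinv hψc hψ hφ fun n x ↦ (f n).symm_apply_apply x,
    hinv hφc hφ hψ fun n x ↦ (f n).apply_symm_apply x⟩, hφc, hψc⟩, hφ⟩

/-- Finitely many pairwise disjoint closed discs in the closed unit disc, each with a ratio which
prescribes the radial stretch to be performed in the disc. -/
structure StretchPacking where
  n : ℕ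
  z : Fin n → ℂ
  r : Fin n → ℝ
  σ : Fin n → ℝ
  r_pos : ∀ i, 0 < r i
  σ_pos : ∀ i, 0 < σ i
  σ_le : ∀ i, σ i ≤ 1 / 2
  norm_add_le : ∀ i, ‖z i‖ + r i ≤ 1
  disjoint : Pairwise fun i j ↦ Disjoint (closedBall (z i) (r i)) (closedBall (z j) (r j))

theorem StretchPacking.r_le (P : StretchPacking) (i : Fin P.n) : P.r i ≤ 1 := by
  linarith [P.norm_add_le i, norm_nonneg (P.z i)]

theorem StretchPacking.sum_sq_le_one (R : StretchPacking) : ∑ i, R.r i ^ 2 ≤ 1 := by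
  have := sum_sq_le_of_disjoint Finset.univ R.z R.r (fun i _ ↦ (R.r_pos i).le)
    (fun i _ j _ hij ↦ R.disjoint hij) (c := 0) zero_le_one
    (fun i _ ↦ closedBall_subset_closedBall' (by
      rw [dist_zero_right]; linarith [R.norm_add_le i]))
  simpa using this

/-- A disc in the source (centre `a`, radius `s`) and the corresponding disc in the target (centre
`b`, radius `t`), a stretching ratio, and the number of ancestors. -/
structure StretchNode where
  a : ℂ
  b : ℂ
  s : ℝ
  t : ℝ
  σ : ℝ
  age : ℕ
  s_pos : 0 < s
  t_pos : 0 < t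
  σ_pos : 0 < σ
  σ_le : σ ≤ 1 / 2

/-- The disc with index `i` of a packing, rescaled to the discs of centres `a`, `b` and radii `ρ`,
`ρ'`. -/
noncomputable def StretchPacking.node (P : StretchPacking) (a b : ℂ) {ρ ρ' : ℝ} (hρ : 0 < ρ)
    (hρ' : 0 < ρ') (age : ℕ) (i : Fin P.n) : StretchNode where
  a := a + ρ • P.z i
  b := b + ρ' • P.z i
  s := ρ * P.r i
  t := ρ' * P.r i
  σ := P.σ i
  age := age
  s_pos := mul_pos hρ (P.r_pos i)
  t_pos := mul_pos hρ' (P.r_pos i)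
  σ_pos := P.σ_pos i
  σ_le := P.σ_le i

theorem closedBall_add_smul_subset {a z : ℂ} {ρ r : ℝ} (hρ : 0 < ρ) (h : ‖z‖ + r ≤ 1) :
    closedBall (a + ρ • z) (ρ * r) ⊆ closedBall a ρ := by
  refine closedBall_subset_closedBall' ?_
  rw [dist_eq_norm, add_sub_cancel_left, norm_smul, Real.norm_of_nonneg hρ.le]
  nlinarith

theorem disjoint_closedBall_add_smul {a z w : ℂ} {ρ r s : ℝ} (hρ : 0 < ρ) (hr : 0 ≤ r) (hs : 0 ≤ s)
    (h : Disjoint (closedBall z r) (closedBall w s)) :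
    Disjoint (closedBall (a + ρ • z) (ρ * r)) (closedBall (a + ρ • w) (ρ * s)) := by
  refine closedBall_disjoint_closedBall ?_
  rw [dist_add_left, dist_smul₀, Real.norm_of_nonneg hρ.le, ← mul_add]
  exact mul_lt_mul_of_pos_left ((disjoint_closedBall_closedBall_iff hr hs).1 h) hρ

namespace StretchNode

variable {K : ℝ}

/-- The source disc. -/
def disc (ν : StretchNode) : Set ℂ := closedBall ν.a ν.s

/-- The similarity from the source disc to the target disc. -/
noncomputable def similarity (ν : StretchNode) (z : ℂ) : ℂ := ν.b + (ν.t / ν.s) • (z - ν.a)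

theorem pow_pos (ν : StretchNode) (K : ℝ) : 0 < ν.σ ^ K := Real.rpow_pos_of_pos ν.σ_pos K

theorem σ_le_one (ν : StretchNode) : ν.σ ≤ 1 := ν.σ_le.trans (by norm_num)

theorem pow_le_half (ν : StretchNode) (hK : 1 ≤ K) : ν.σ ^ K ≤ 1 / 2 := by
  refine (Real.rpow_le_rpow_of_exponent_ge ν.σ_pos ν.σ_le_one hK).trans ?_
  rw [Real.rpow_one]
  exact ν.σ_le

theorem pow_le_one (ν : StretchNode) (hK : 1 ≤ K) : ν.σ ^ K ≤ 1 :=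
  (ν.pow_le_half hK).trans (by norm_num)

variable (hK : 1 ≤ K)

/-- The radial stretch in the source disc. -/
noncomputable def stretch (ν : StretchNode) : ℂ ≃ₜ ℂ :=
  -- Inner ratio `σ ^ K` and exponent `K⁻¹`, so the inner disc is mapped onto a disc of ratio `σ`.
  discStretch ν.a ν.s_pos (ν.pow_pos K) (ν.pow_le_one hK) (inv_pos.2 (zero_lt_one.trans_le hK))

theorem stretch_apply (ν : StretchNode) (z : ℂ) :
    ν.stretch hK z = discStretchFun ν.a ν.s (ν.σ ^ K) K⁻¹ z := rfl

theorem stretch_of_notMem (ν : StretchNode) {z : ℂ} (hz : z ∉ ν.disc) : ν.stretch hK z = z :=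
  discStretchFun_of_le_dist ν.s_pos (ν.pow_le_one hK) (not_le.1 hz).le

theorem stretch_mem (ν : StretchNode) {z : ℂ} (hz : z ∈ ν.disc) : ν.stretch hK z ∈ ν.disc :=
  discStretchFun_mem_closedBall ν.s_pos (ν.pow_pos K) (ν.pow_le_one hK)
    (inv_pos.2 (zero_lt_one.trans_le hK)) hz

theorem stretch_of_mem_inner (ν : StretchNode) {z : ℂ} (hz : z ∈ closedBall ν.a (ν.σ ^ K * ν.s)) :
    ν.stretch hK z = ν.a + (ν.σ / ν.σ ^ K) • (z - ν.a) := by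
  rw [stretch_apply, discStretchFun_of_dist_le ν.s_pos (ν.pow_le_one hK) hz,
    ← Real.rpow_mul ν.σ_pos.le, mul_sub, mul_inv_cancel₀ (by positivity), mul_one,
    Real.rpow_sub ν.σ_pos, Real.rpow_one]

theorem dist_similarity_le (ν : StretchNode) {z : ℂ} (hz : z ∈ ν.disc) :
    dist (ν.similarity z) ν.b ≤ ν.t := by
  have h : dist z ν.a ≤ ν.s := hz
  rw [similarity, dist_eq_norm, add_sub_cancel_left, norm_smul, ← dist_eq_norm,
    Real.norm_of_nonneg (div_pos ν.t_pos ν.s_pos).le, div_mul_eq_mul_div, div_le_iff₀ ν.s_pos]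
  exact mul_le_mul_of_nonneg_left h ν.t_pos.le

/-- The discs of the next generation inside a disc. -/
noncomputable def children (P : ℕ → StretchPacking) (K : ℝ) (ν : StretchNode) : List StretchNode :=
  List.ofFn ((P ν.age).node ν.a ν.b (mul_pos (ν.pow_pos K) ν.s_pos) (mul_pos ν.σ_pos ν.t_pos)
    (ν.age + 1))

theorem disc_subset_of_mem_children {P : ℕ → StretchPacking} {ν μ : StretchNode}
    (h : μ ∈ ν.children P K) : μ.disc ⊆ closedBall ν.a (ν.σ ^ K * ν.s) := by
  obtain ⟨i, rfl⟩ := List.mem_ofFn.1 h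
  exact closedBall_add_smul_subset (mul_pos (ν.pow_pos K) ν.s_pos) ((P ν.age).norm_add_le i)

theorem disc_subset_disc_of_mem_children (hK : 1 ≤ K) {P : ℕ → StretchPacking} {ν μ : StretchNode}
    (h : μ ∈ ν.children P K) : μ.disc ⊆ ν.disc :=
  (disc_subset_of_mem_children h).trans (closedBall_subset_closedBall
    (mul_le_of_le_one_left ν.s_pos.le (ν.pow_le_one hK)))

/-- Successive radial stretches in the discs of a list. -/
noncomputable def listStretch : List StretchNode → (ℂ ≃ₜ ℂ)
  | [] => Homeomorph.refl ℂ
  | ν :: L => (ν.stretch hK).trans (listStretch L)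

theorem listStretch_of_notMem {L : List StretchNode} {z : ℂ} (hz : ∀ ν ∈ L, z ∉ ν.disc) :
    listStretch hK L z = z := by
  induction L with
  | nil => rfl
  | cons ν L ih =>
    rw [listStretch, Homeomorph.trans_apply, ν.stretch_of_notMem hK (hz ν List.mem_cons_self)]
    exact ih fun μ hμ ↦ hz μ (List.mem_cons_of_mem _ hμ)

/-- Each stretch preserves its own disc and fixes its complement, so with disjoint discs the other
stretches never act on the point. -/
theorem listStretch_of_mem {L : List StretchNode}
    (hL : L.Pairwise fun μ ν ↦ Disjoint μ.disc ν.disc) {ν : StretchNode} (hν : ν ∈ L) {z : ℂ}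
    (hz : z ∈ ν.disc) : listStretch hK L z = ν.stretch hK z := by
  induction L with
  | nil => exact absurd hν List.not_mem_nil
  | cons μ L ih =>
    rw [List.pairwise_cons] at hL
    rw [listStretch, Homeomorph.trans_apply]
    rcases List.mem_cons.1 hν with rfl | hν
    · exact listStretch_of_notMem hK fun μ hμ h ↦
        disjoint_left.1 (hL.1 μ hμ) (ν.stretch_mem hK hz) h
    · rw [μ.stretch_of_notMem hK (disjoint_right.1 (hL.1 ν hν) hz)]
      exact ih hL.2 hν

theorem exists_lipschitzWith_listStretch (L : List StretchNode) :
    ∃ C, LipschitzWith C (listStretch hK L) := by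
  induction L with
  | nil => exact ⟨1, LipschitzWith.id⟩
  | cons ν L ih =>
    obtain ⟨C, hC⟩ := ih
    obtain ⟨D, hD⟩ := exists_lipschitzWith_discStretchFun (c := ν.a) (s := ν.s) (q := K⁻¹)
      (ν.pow_pos K) (ν.pow_le_one hK)
    exact ⟨C * D, hC.comp hD⟩

end StretchNode

/-! ### The stages of the construction -/

section Stages

/-- The dyadic radius `2⁻ᴺ`. -/
noncomputable def dyadic (N : ℕ) : ℝ := (1 / 2) ^ N

theorem dyadic_pos (N : ℕ) : 0 < dyadic N := by unfold dyadic; positivity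

theorem dyadic_succ (N : ℕ) : dyadic (N + 1) = dyadic N / 2 := by
  unfold dyadic; rw [pow_succ]; ring

theorem dyadic_antitone : Antitone dyadic :=
  antitone_nat_of_succ_le fun n ↦ by rw [dyadic_succ]; linarith [dyadic_pos n]

theorem tendsto_dyadic : Tendsto dyadic atTop (𝓝 0) :=
  tendsto_pow_atTop_nhds_zero_of_lt_one (by norm_num) (by norm_num)

theorem dyadic_div_eight_pos (N : ℕ) : 0 < dyadic N / 8 := by linarith [dyadic_pos N]

/-- The centre of the disc added at stage `N`. -/
noncomputable def newCenter (N : ℕ) : ℂ := ((3 / 4 * dyadic N : ℝ) : ℂ)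

theorem norm_newCenter (N : ℕ) : ‖newCenter N‖ = 3 / 4 * dyadic N := by
  rw [newCenter, Complex.norm_real, Real.norm_of_nonneg (by linarith [dyadic_pos N])]

/-- The annuli in question are disjoint for distinct `N`; this separates the batches of copies. -/
theorem norm_bounds_of_mem_newBall {N : ℕ} {w : ℂ}
    (hw : w ∈ closedBall (newCenter N) (dyadic N / 8)) :
    dyadic (N + 1) < ‖w‖ ∧ ‖w‖ < dyadic N := by
  rw [mem_closedBall, dist_eq_norm] at hw
  have h1 := norm_newCenter N
  have h2 := norm_sub_norm_le w (newCenter N)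
  have h3 := norm_sub_norm_le (newCenter N) w
  rw [norm_sub_rev] at h3
  have := dyadic_pos N
  rw [dyadic_succ]
  constructor <;> linarith

/-- The first generation discs added at stage `N`. -/
noncomputable def newNodes (Q : ℕ → StretchPacking) (N : ℕ) : List StretchNode :=
  List.ofFn ((Q N).node (newCenter N) (newCenter N) (dyadic_div_eight_pos N)
    (dyadic_div_eight_pos N) 0)

/-- The discs in which stretches are performed at stage `N`. -/
noncomputable def stageNodes (P Q : ℕ → StretchPacking) (K : ℝ) : ℕ → List StretchNode
  | 0 => newNodes Q 0
  | N + 1 => (stageNodes P Q K N).flatMap (StretchNode.children P K) ++ newNodes Q (N + 1)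

variable {P Q : ℕ → StretchPacking} {K : ℝ}

theorem disc_subset_of_mem_newNodes {N : ℕ} {ν : StretchNode} (h : ν ∈ newNodes Q N) :
    ν.disc ⊆ closedBall (newCenter N) (dyadic N / 8) := by
  obtain ⟨i, rfl⟩ := List.mem_ofFn.1 h
  exact closedBall_add_smul_subset (dyadic_div_eight_pos N) ((Q N).norm_add_le i)

theorem StretchPacking.pairwise_disjoint_node (R : StretchPacking) (a b : ℂ) {ρ ρ' : ℝ} (hρ : 0 < ρ)
    (hρ' : 0 < ρ') (age : ℕ) : (List.ofFn (R.node a b hρ hρ' age)).Pairwise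
      fun μ ν ↦ Disjoint μ.disc ν.disc := by
  rw [List.pairwise_ofFn]
  intro i j hij
  exact disjoint_closedBall_add_smul hρ (R.r_pos i).le (R.r_pos j).le (R.disjoint hij.ne)

theorem forall_mem_stageNodes {p : ℕ → StretchNode → Prop}
    (hnew : ∀ N, ∀ ν ∈ newNodes Q N, p N ν)
    (hchild : ∀ N ν, ν ∈ stageNodes P Q K N → p N ν → ∀ μ ∈ ν.children P K, p (N + 1) μ) (N : ℕ) :
    ∀ ν ∈ stageNodes P Q K N, p N ν := by
  induction N with
  | zero => exact hnew 0
  | succ N ih =>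
    intro μ hμ
    rcases List.mem_append.1 hμ with hμ | hμ
    · obtain ⟨ν, hν, hμ⟩ := List.mem_flatMap.1 hμ
      exact hchild N ν hν (ih ν hν) μ hμ
    · exact hnew _ μ hμ

/-- Descendants stay inside their first ancestor. Hence earlier stages leave the disc of radius
`dyadic (N + 1)` untouched, and the batch `N + 1` is added there. -/
theorem lt_norm_of_mem_stageNodes (hK : 1 ≤ K) (N : ℕ) :
    ∀ ν ∈ stageNodes P Q K N, ∀ z ∈ ν.disc, dyadic (N + 1) < ‖z‖ := by
  refine forall_mem_stageNodes (p := fun N ν ↦ ∀ z ∈ ν.disc, dyadic (N + 1) < ‖z‖)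
    (fun N ν hν z hz ↦ (norm_bounds_of_mem_newBall (disc_subset_of_mem_newNodes hν hz)).1) ?_ N
  intro N ν _ ih μ hμ z hz
  exact (dyadic_antitone (Nat.le_succ _)).trans_lt
    (ih z (StretchNode.disc_subset_disc_of_mem_children hK hμ hz))

theorem radii_le_of_mem_stageNodes (hK : 1 ≤ K) (N : ℕ) :
    ∀ ν ∈ stageNodes P Q K N, ν.s ≤ dyadic N ∧ ν.t ≤ dyadic N := by
  refine forall_mem_stageNodes (p := fun N ν ↦ ν.s ≤ dyadic N ∧ ν.t ≤ dyadic N) ?_ ?_ N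
  · intro N ν hν
    obtain ⟨i, rfl⟩ := List.mem_ofFn.1 hν
    have h : dyadic N / 8 * (Q N).r i ≤ dyadic N := by
      have := (Q N).r_le i
      have := dyadic_pos N
      nlinarith
    exact ⟨h, h⟩
  · rintro N ν _ ⟨hs, ht⟩ μ hμ
    obtain ⟨i, rfl⟩ := List.mem_ofFn.1 hμ
    have h1 := (P ν.age).r_le i
    have h0 := (P ν.age).r_pos i
    have h2 := ν.pow_le_half hK
    have h3 := ν.σ_le
    have h4 := ν.s_pos
    have h5 := ν.t_pos
    have h6 := ν.pow_pos K
    have h7 := ν.σ_pos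
    have h8 : 0 ≤ 1 / 2 * dyadic N := by linarith [dyadic_pos N]
    simp only [StretchPacking.node]
    rw [dyadic_succ]
    constructor
    · calc ν.σ ^ K * ν.s * (P ν.age).r i ≤ 1 / 2 * dyadic N * 1 := by gcongr
        _ = _ := by ring
    · calc ν.σ * ν.t * (P ν.age).r i ≤ 1 / 2 * dyadic N * 1 := by gcongr
        _ = _ := by ring

theorem pairwise_disjoint_stageNodes (hK : 1 ≤ K) (N : ℕ) :
    (stageNodes P Q K N).Pairwise fun μ ν ↦ Disjoint μ.disc ν.disc := by
  induction N with
  | zero => exact StretchPacking.pairwise_disjoint_node _ _ _ _ _ _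
  | succ N ih =>
    rw [stageNodes, List.pairwise_append]
    refine ⟨List.pairwise_flatMap.2 ⟨fun ν _ ↦ StretchPacking.pairwise_disjoint_node _ _ _ _ _ _,
      ih.imp fun {μ ν} h μ' hμ ν' hν ↦ ?_⟩, StretchPacking.pairwise_disjoint_node _ _ _ _ _ _, ?_⟩
    · exact h.mono (StretchNode.disc_subset_disc_of_mem_children hK hμ)
        (StretchNode.disc_subset_disc_of_mem_children hK hν)
    · intro μ hμ ν hν
      obtain ⟨μ', hμ', hμ⟩ := List.mem_flatMap.1 hμ
      refine disjoint_left.2 fun z hz hz' ↦ ?_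
      have h1 := lt_norm_of_mem_stageNodes hK N μ' hμ' z
        (StretchNode.disc_subset_disc_of_mem_children hK hμ hz)
      have h2 := (norm_bounds_of_mem_newBall (disc_subset_of_mem_newNodes hν hz')).2
      exact lt_asymm h1 h2

variable (P Q) in
/-- The composition of the stretches of the stages before `N`. -/
noncomputable def stageMap (hK : 1 ≤ K) : ℕ → (ℂ ≃ₜ ℂ)
  | 0 => Homeomorph.refl ℂ
  -- The newest stretches act first, in the source; the earlier map follows and is a similarity on
  -- each of their discs.
  | N + 1 => (StretchNode.listStretch hK (stageNodes P Q K N)).trans (stageMap hK N)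

theorem stageMap_succ_apply (hK : 1 ≤ K) (N : ℕ) (z : ℂ) : stageMap P Q hK (N + 1) z =
    stageMap P Q hK N (StretchNode.listStretch hK (stageNodes P Q K N) z) := rfl

theorem stageMap_succ_of_mem (hK : 1 ≤ K) {N : ℕ} {ν : StretchNode} (hν : ν ∈ stageNodes P Q K N)
    {z : ℂ} (hz : z ∈ ν.disc) :
    stageMap P Q hK (N + 1) z = stageMap P Q hK N (ν.stretch hK z) := by
  rw [stageMap_succ_apply,
    StretchNode.listStretch_of_mem hK (pairwise_disjoint_stageNodes hK N) hν hz]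

theorem stageMap_succ_of_notMem (hK : 1 ≤ K) {N : ℕ} {z : ℂ}
    (hz : ∀ ν ∈ stageNodes P Q K N, z ∉ ν.disc) :
    stageMap P Q hK (N + 1) z = stageMap P Q hK N z := by
  rw [stageMap_succ_apply, StretchNode.listStretch_of_notMem hK hz]

theorem stageMap_of_norm_le (hK : 1 ≤ K) {N : ℕ} {z : ℂ} (hz : ‖z‖ ≤ dyadic N) :
    stageMap P Q hK N z = z := by
  induction N with
  | zero => rfl
  | succ N ih =>
    rw [stageMap_succ_of_notMem hK fun ν hν h ↦
      (lt_norm_of_mem_stageNodes hK N ν hν z h).not_ge hz]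
    exact ih (hz.trans (dyadic_antitone N.le_succ))

/-- New discs lie where the earlier map is the identity. A child lies in the inner disc of its
parent, where the stretch is the dilation by `σ / σ^K`; composed with the parent's similarity this
gives the ratio of the child's radii. -/
theorem stageMap_eq_similarity (hK : 1 ≤ K) (N : ℕ) :
    ∀ ν ∈ stageNodes P Q K N, ∀ z ∈ ν.disc, stageMap P Q hK N z = ν.similarity z := by
  refine forall_mem_stageNodes
    (p := fun N ν ↦ ∀ z ∈ ν.disc, stageMap P Q hK N z = ν.similarity z) ?_ ?_ N
  · intro N ν hν z hz
    rw [stageMap_of_norm_le hK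
      (norm_bounds_of_mem_newBall (disc_subset_of_mem_newNodes hν hz)).2.le]
    have hs := ν.s_pos
    obtain ⟨i, rfl⟩ := List.mem_ofFn.1 hν
    rw [StretchNode.similarity]
    simp only [StretchPacking.node] at hs ⊢
    rw [div_self hs.ne', one_smul]
    ring
  · intro N ν hν ih μ hμ z hz
    have hz1 := StretchNode.disc_subset_of_mem_children hμ hz
    have hz2 := StretchNode.disc_subset_disc_of_mem_children hK hμ hz
    rw [stageMap_succ_of_mem hK hν hz2, ih _ (ν.stretch_mem hK hz2), ν.stretch_of_mem_inner hK hz1]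
    obtain ⟨i, rfl⟩ := List.mem_ofFn.1 hμ
    have h1 := ν.s_pos.ne'
    have h2 := (ν.pow_pos K).ne'
    have h3 := ((P ν.age).r_pos i).ne'
    simp only [StretchNode.similarity, StretchPacking.node, Complex.real_smul]
    push_cast
    have h1' : (ν.s : ℂ) ≠ 0 := by exact_mod_cast h1
    have h2' : ((ν.σ ^ K : ℝ) : ℂ) ≠ 0 := by exact_mod_cast h2
    have h3' : ((P ν.age).r i : ℂ) ≠ 0 := by exact_mod_cast h3
    field_simp
    ring

/-- A point and its stretched image lie in the same source disc, so their images lie in the same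
target disc, of radius at most `2⁻ᴺ`. -/
theorem dist_stageMap_succ_le (hK : 1 ≤ K) (N : ℕ) (z : ℂ) :
    dist (stageMap P Q hK N z) (stageMap P Q hK (N + 1) z) ≤ 2 * (1 / 2) ^ N := by
  by_cases h : ∃ ν ∈ stageNodes P Q K N, z ∈ ν.disc
  · obtain ⟨ν, hν, hz⟩ := h
    rw [stageMap_succ_of_mem hK hν hz, stageMap_eq_similarity hK N ν hν z hz,
      stageMap_eq_similarity hK N ν hν _ (ν.stretch_mem hK hz)]
    have h1 := ν.dist_similarity_le hz
    have h2 := ν.dist_similarity_le (ν.stretch_mem hK hz)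
    have h3 := (radii_le_of_mem_stageNodes hK N ν hν).2
    have h4 := dist_triangle_right (ν.similarity z) (ν.similarity (ν.stretch hK z)) ν.b
    rw [dyadic] at h3
    linarith
  · push Not at h
    rw [stageMap_succ_of_notMem hK h, dist_self]
    positivity

/-- The preimage at stage `N` is obtained from the preimage `v` at stage `N + 1` by stretching,
which stays in the same source disc. -/
theorem dist_stageMap_symm_succ_le (hK : 1 ≤ K) (N : ℕ) (w : ℂ) :
    dist ((stageMap P Q hK N).symm w) ((stageMap P Q hK (N + 1)).symm w) ≤ 2 * (1 / 2) ^ N := by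
  set v := (stageMap P Q hK (N + 1)).symm w with hv
  have h1 : (stageMap P Q hK N).symm w
      = StretchNode.listStretch hK (stageNodes P Q K N) v := by
    rw [Homeomorph.symm_apply_eq, ← stageMap_succ_apply, hv, Homeomorph.apply_symm_apply]
  rw [h1]
  by_cases h : ∃ ν ∈ stageNodes P Q K N, v ∈ ν.disc
  · obtain ⟨ν, hν, hz⟩ := h
    rw [StretchNode.listStretch_of_mem hK (pairwise_disjoint_stageNodes hK N) hν hz]
    have h1 : dist v ν.a ≤ ν.s := hz
    have h2 : dist (ν.stretch hK v) ν.a ≤ ν.s := ν.stretch_mem hK hz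
    have h3 := (radii_le_of_mem_stageNodes hK N ν hν).1
    have h4 := dist_triangle_right (ν.stretch hK v) v ν.a
    rw [dyadic] at h3
    linarith
  · push Not at h
    rw [StretchNode.listStretch_of_notMem hK h, dist_self]
    positivity

theorem exists_lipschitzWith_stageMap (hK : 1 ≤ K) (N : ℕ) :
    ∃ C, LipschitzWith C (stageMap P Q hK N) := by
  induction N with
  | zero => exact ⟨1, LipschitzWith.id⟩
  | succ N ih =>
    obtain ⟨C, hC⟩ := ih
    obtain ⟨D, hD⟩ := StretchNode.exists_lipschitzWith_listStretch hK (stageNodes P Q K N)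
    exact ⟨C * D, hC.comp hD⟩

/-! ### Differentials of the stages and the area of the discs. -/

variable (P Q K) in
/-- The union of the discs of stage `N`. -/
def stageUnion (N : ℕ) : Set ℂ := ⋃ ν ∈ stageNodes P Q K N, ν.disc

theorem mem_stageUnion {N : ℕ} {z : ℂ} :
    z ∈ stageUnion P Q K N ↔ ∃ ν ∈ stageNodes P Q K N, z ∈ ν.disc := by
  simp [stageUnion]

theorem isClosed_stageUnion (N : ℕ) : IsClosed (stageUnion P Q K N) :=
  Set.Finite.isClosed_biUnion (List.finite_toSet _) fun _ _ ↦ isClosed_closedBall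

/-- Off the null boundary circles, the point is either outside the closed union of the discs, where
nothing changes locally, or inside one, where the chain rule multiplies the differential of a
stretch by the similarity ratio `c`. -/
theorem ae_fderiv_stageMap_succ (hK : 1 ≤ K) (N : ℕ) : ∀ᵐ z,
    fderiv ℝ (stageMap P Q hK (N + 1)) z = fderiv ℝ (stageMap P Q hK N) z ∨
    ∃ (c : ℝ) (A : ℂ →L[ℝ] ℂ), HasDistortion K A ∧ 1 ≤ ‖A‖ ∧
      fderiv ℝ (stageMap P Q hK N) z = c • ContinuousLinearMap.id ℝ ℂ ∧
      fderiv ℝ (stageMap P Q hK (N + 1)) z = c • A := by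
  have hae : ∀ᵐ z : ℂ, ∀ ν ∈ stageNodes P Q K N, dist z ν.a ≠ ν.s ∧
      dist z ν.a ≠ ν.σ ^ K * ν.s := by
    have hfin : {ν | ν ∈ stageNodes P Q K N}.Countable := (List.finite_toSet _).countable
    refine (ae_ball_iff hfin).2 fun ν _ ↦ ?_
    have h (r : ℝ) : ∀ᵐ z : ℂ, dist z ν.a ≠ r := by
      filter_upwards [compl_mem_ae_iff.2 (Measure.addHaar_sphere volume ν.a r)] with z hz h
      exact hz h
    exact (h _).and (h _)
  filter_upwards [hae] with z hz
  by_cases h : ∃ ν ∈ stageNodes P Q K N, z ∈ ν.disc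
  · obtain ⟨ν, hν, hzν⟩ := h
    right
    have hlt : dist z ν.a < ν.s := lt_of_le_of_ne hzν (hz ν hν).1
    have hev : ∀ᶠ w in 𝓝 z, w ∈ ν.disc := closedBall_mem_nhds_of_mem hlt
    obtain ⟨A, hA, hD, h1⟩ := discStretchFun_differential hK ν.s_pos (ν.pow_pos K)
      (ν.pow_le_one hK) (hz ν hν).2 (hz ν hν).1
    have hsim (w : ℂ) : HasFDerivAt ν.similarity ((ν.t / ν.s) • ContinuousLinearMap.id ℝ ℂ) w :=
      (((hasFDerivAt_id w).sub_const ν.a).const_smul (ν.t / ν.s)).const_add ν.b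
    refine ⟨ν.t / ν.s, A, hD, h1, ?_, ?_⟩
    · refine HasFDerivAt.fderiv ((hsim z).congr_of_eventuallyEq ?_)
      filter_upwards [hev] with w hw
      exact stageMap_eq_similarity hK N ν hν w hw
    · have hcomp := (hsim (ν.stretch hK z)).comp z hA
      refine HasFDerivAt.fderiv (HasFDerivAt.congr_of_eventuallyEq (hcomp.congr_fderiv ?_) ?_)
      · ext1 v; simp
      · filter_upwards [hev] with w hw
        rw [stageMap_succ_of_mem hK hν hw,
          stageMap_eq_similarity hK N ν hν _ (ν.stretch_mem hK hw)]
        rfl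
  · left
    have hev : ∀ᶠ w in 𝓝 z, w ∉ stageUnion P Q K N :=
      (isClosed_stageUnion N).isOpen_compl.mem_nhds fun h' ↦ h (mem_stageUnion.1 h')
    refine Filter.EventuallyEq.fderiv_eq ?_
    filter_upwards [hev] with w hw
    exact stageMap_succ_of_notMem hK fun ν hν hwν ↦ hw (mem_stageUnion.2 ⟨ν, hν, hwν⟩)

theorem ae_hasDistortion_stageMap (hK : 1 ≤ K) (N : ℕ) :
    ∀ᵐ z, HasDistortion K (fderiv ℝ (stageMap P Q hK N) z) := by
  induction N with
  | zero =>
    refine Eventually.of_forall fun z ↦ ?_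
    have : fderiv ℝ (stageMap P Q hK 0) z = ContinuousLinearMap.id ℝ ℂ := fderiv_id
    rw [this]
    exact hasDistortion_id hK
  | succ N ih =>
    filter_upwards [ih, ae_fderiv_stageMap_succ hK N] with z h1 h2
    rcases h2 with h2 | ⟨c, A, hA, -, -, h2⟩
    · rwa [h2]
    · rw [h2]
      exact hA.smul c

theorem ae_norm_fderiv_stageMap_le (hK : 1 ≤ K) (N : ℕ) :
    ∀ᵐ z, ‖fderiv ℝ (stageMap P Q hK N) z‖ ≤ ‖fderiv ℝ (stageMap P Q hK (N + 1)) z‖ := by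
  filter_upwards [ae_fderiv_stageMap_succ hK N] with z h2
  rcases h2 with h2 | ⟨c, A, -, hA, h1, h2⟩
  · rw [h2]
  · rw [h1, h2, norm_smul, norm_smul, ContinuousLinearMap.norm_id]
    gcongr

/-- The total area of the discs of stage `N`, up to the factor `π`. -/
theorem sum_sq_stageNodes_le (hK : 1 ≤ K) (N : ℕ) :
    ((stageNodes P Q K N).map fun ν ↦ ν.s ^ 2).sum ≤ dyadic N := by
  have hnode (R : StretchPacking) (a b : ℂ) {ρ ρ' : ℝ} (hρ : 0 < ρ) (hρ' : 0 < ρ') (age : ℕ) :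
      ((List.ofFn (R.node a b hρ hρ' age)).map fun ν ↦ ν.s ^ 2).sum ≤ ρ ^ 2 := by
    rw [List.map_ofFn, List.sum_ofFn]
    simp only [Function.comp_def, StretchPacking.node, mul_pow]
    rw [← Finset.mul_sum]
    exact mul_le_of_le_one_right (sq_nonneg _) R.sum_sq_le_one
  -- The bound with `/ 2` closes the induction: children keep at most a quarter of the area since `σ
  -- ^ K ≤ 1 / 2`, and `dyadic N / 4 + dyadic (N + 1) / 2 = dyadic (N + 1)`.
  have hnew (N : ℕ) : ((newNodes Q N).map fun ν ↦ ν.s ^ 2).sum ≤ dyadic N / 2 := by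
    refine (hnode _ _ _ _ _ _).trans ?_
    have h1 : dyadic N ≤ 1 := dyadic_antitone N.zero_le |>.trans_eq (by simp [dyadic])
    nlinarith [dyadic_pos N]
  induction N with
  | zero =>
    have := hnew 0
    have := dyadic_pos 0
    rw [stageNodes]
    linarith
  | succ N ih =>
    rw [stageNodes, List.map_append, List.sum_append, List.map_flatMap]
    have h1 : ∀ L : List StretchNode,
        ((L.flatMap fun ν ↦ (ν.children P K).map fun ν ↦ ν.s ^ 2)).sum
          ≤ 1 / 4 * (L.map fun ν ↦ ν.s ^ 2).sum := by
      intro L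
      induction L with
      | nil => simp
      | cons ν L ihL =>
        rw [List.flatMap_cons, List.sum_append, List.map_cons, List.sum_cons]
        have h2 : ((ν.children P K).map fun ν ↦ ν.s ^ 2).sum ≤ (ν.σ ^ K * ν.s) ^ 2 :=
          hnode _ _ _ _ _ _
        have h3 : (ν.σ ^ K * ν.s) ^ 2 ≤ (1 / 2 * ν.s) ^ 2 := by
          have := ν.pow_pos K
          have := ν.s_pos
          gcongr
          exact ν.pow_le_half hK
        nlinarith
    have h2 := h1 (stageNodes P Q K N)
    have h3 := hnew (N + 1)
    have := dyadic_pos N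
    rw [dyadic_succ] at h3 ⊢
    linarith

variable (P Q K) in
/-- A closed set containing the discs of all the stages from `N` on. -/
def stageTail (N : ℕ) : Set ℂ := stageUnion P Q K N ∪ closedBall 0 (dyadic N)

theorem isClosed_stageTail (N : ℕ) : IsClosed (stageTail P Q K N) :=
  (isClosed_stageUnion N).union isClosed_closedBall

theorem stageTail_antitone (hK : 1 ≤ K) : Antitone (stageTail P Q K) := by
  refine antitone_nat_of_succ_le fun N z hz ↦ ?_
  rcases hz with hz | hz
  · obtain ⟨μ, hμ, hz⟩ := mem_stageUnion.1 hz
    rcases List.mem_append.1 hμ with hμ | hμ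
    · obtain ⟨ν, hν, hμ⟩ := List.mem_flatMap.1 hμ
      exact Or.inl (mem_stageUnion.2 ⟨ν, hν,
        StretchNode.disc_subset_disc_of_mem_children hK hμ hz⟩)
    · right
      rw [mem_closedBall_zero_iff]
      exact (norm_bounds_of_mem_newBall (disc_subset_of_mem_newNodes hμ hz)).2.le.trans
        (dyadic_antitone N.le_succ)
  · exact Or.inr (closedBall_subset_closedBall (dyadic_antitone N.le_succ) hz)

theorem volume_stageTail_le (hK : 1 ≤ K) (N : ℕ) :
    volume (stageTail P Q K N) ≤ ENNReal.ofReal (Real.pi * (2 * dyadic N)) := by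
  have hvol (c : ℂ) {r : ℝ} (hr : 0 ≤ r) :
      volume (closedBall c r) = ENNReal.ofReal (Real.pi * r ^ 2) := by
    rw [← volume_real_closedBall c hr, ofReal_measureReal measure_closedBall_lt_top.ne]
  have h1 : ∀ L : List StretchNode, volume (⋃ ν ∈ L, ν.disc)
      ≤ ENNReal.ofReal (Real.pi * (L.map fun ν ↦ ν.s ^ 2).sum) := by
    intro L
    induction L with
    | nil => simp
    | cons ν L ih =>
      have e : (⋃ μ ∈ ν :: L, μ.disc) = ν.disc ∪ ⋃ μ ∈ L, μ.disc := by
        ext z; simp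
      rw [e, List.map_cons, List.sum_cons, mul_add, ENNReal.ofReal_add (by positivity)
        (mul_nonneg Real.pi_pos.le (List.sum_nonneg (by
          intro x hx
          obtain ⟨μ, -, rfl⟩ := List.mem_map.1 hx
          positivity)))]
      refine (measure_union_le _ _).trans (add_le_add (hvol _ ν.s_pos.le).le ih)
  have h0 := dyadic_pos N
  have h2 : dyadic N ≤ 1 := dyadic_antitone N.zero_le |>.trans_eq (by simp [dyadic])
  have h3 := sum_sq_stageNodes_le (P := P) (Q := Q) hK N
  refine (measure_union_le _ _).trans ((add_le_add (h1 _) (hvol 0 h0.le).le).trans ?_)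
  rw [two_mul, mul_add, ENNReal.ofReal_add (by positivity) (by positivity)]
  gcongr
  nlinarith

/-- The tails decrease, so a point outside the tail at `N` is never moved by a later stretch. -/
theorem stageMap_eq_of_notMem (hK : 1 ≤ K) {N n : ℕ} (hn : N ≤ n) {z : ℂ}
    (hz : z ∉ stageTail P Q K N) : stageMap P Q hK n z = stageMap P Q hK N z := by
  induction n, hn using Nat.le_induction with
  | base => rfl
  | succ n hn ih =>
    rw [stageMap_succ_of_notMem hK, ih]
    exact fun ν hν h ↦ hz (stageTail_antitone hK hn (Or.inl (mem_stageUnion.2 ⟨ν, hν, h⟩)))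

/-! ### Coded points and the limit map. -/

/-- Along a sequence of letters, the centres of the discs are given by the source and target
codes. -/
theorem exists_mem_stageNodes (N : ℕ) (i : Fin (Q N).n) (x : ∀ n, Fin (P n).n) (n : ℕ) :
    ∃ ν ∈ stageNodes P Q K (N + n), ν.age = n ∧
      ν.a = newCenter N + (dyadic N / 8) • (Q N).z i + ((Q N).σ i ^ K * (dyadic N / 8 * (Q N).r i)) •
        codeCenter (fun n ↦ (P n).z) (fun n i ↦ (P n).σ i ^ K * (P n).r i) x n ∧
      ν.σ ^ K * ν.s = ((Q N).σ i ^ K * (dyadic N / 8 * (Q N).r i)) *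
        codeScale (fun n i ↦ (P n).σ i ^ K * (P n).r i) x n ∧
      ν.b = newCenter N + (dyadic N / 8) • (Q N).z i + ((Q N).σ i * (dyadic N / 8 * (Q N).r i)) •
        codeCenter (fun n ↦ (P n).z) (fun n i ↦ (P n).σ i * (P n).r i) x n ∧
      ν.σ * ν.t = ((Q N).σ i * (dyadic N / 8 * (Q N).r i)) *
        codeScale (fun n i ↦ (P n).σ i * (P n).r i) x n := by
  induction n with
  | zero =>
    refine ⟨(Q N).node (newCenter N) (newCenter N) (dyadic_div_eight_pos N)
        (dyadic_div_eight_pos N) 0 i, ?_, rfl, ?_, ?_, ?_, ?_⟩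
    · have : (Q N).node (newCenter N) (newCenter N) (dyadic_div_eight_pos N)
        (dyadic_div_eight_pos N) 0 i ∈ newNodes Q N := List.mem_ofFn.2 ⟨i, rfl⟩
      cases N with
      | zero => exact this
      | succ N => exact List.mem_append_right _ this
    all_goals simp [StretchPacking.node, codeCenter, codeScale]
  | succ n ih =>
    obtain ⟨ν, hν, hage, h1, h2, h3, h4⟩ := ih
    have key : ∃ μ ∈ ν.children P K, μ.age = n + 1 ∧
        μ.a = ν.a + (ν.σ ^ K * ν.s) • (P n).z (x n) ∧ μ.s = ν.σ ^ K * ν.s * (P n).r (x n) ∧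
        μ.b = ν.b + (ν.σ * ν.t) • (P n).z (x n) ∧ μ.t = ν.σ * ν.t * (P n).r (x n) ∧
        μ.σ = (P n).σ (x n) := by
      clear h1 h2 h3 h4
      subst hage
      exact ⟨_, List.mem_ofFn.2 ⟨x ν.age, rfl⟩, rfl, rfl, rfl, rfl, rfl, rfl⟩
    obtain ⟨μ, hμ, k1, k2, k3, k4, k5, k6⟩ := key
    refine ⟨μ, List.mem_append_left _ (List.mem_flatMap.2 ⟨ν, hν, hμ⟩), k1, ?_, ?_, ?_, ?_⟩
    · rw [k2, h2, h1, codeCenter_succ]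
      module
    · rw [k3, h2, k6, codeScale_succ]
      ring
    · rw [k4, h4, h3, codeCenter_succ]
      module
    · rw [k5, h4, k6, codeScale_succ]
      ring

theorem StretchPacking.isDiscCode (P : ℕ → StretchPacking) (hK : 1 ≤ K) :
    IsDiscCode (fun n ↦ (P n).z) (fun n i ↦ (P n).σ i ^ K * (P n).r i) where
  pos n i := mul_pos (Real.rpow_pos_of_pos ((P n).σ_pos i) K) ((P n).r_pos i)
  le_half n i := by
    have h := (P n).r_le i
    have h1 := (P n).σ_le i
    have h2 : (P n).σ i ^ K ≤ (P n).σ i ^ (1 : ℝ) :=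
      Real.rpow_le_rpow_of_exponent_ge ((P n).σ_pos i) (by linarith) hK
    rw [Real.rpow_one] at h2
    have := (P n).r_pos i
    nlinarith
  norm_add_le n i := by
    have h1 := (P n).norm_add_le i
    have h2 : (P n).σ i ^ K ≤ 1 :=
      Real.rpow_le_one ((P n).σ_pos i).le (by linarith [(P n).σ_le i]) (by linarith)
    have := (P n).r_pos i
    nlinarith

/-- The target code is the source code for exponent 1. -/
theorem StretchPacking.isDiscCode_one (P : ℕ → StretchPacking) :
    IsDiscCode (fun n ↦ (P n).z) (fun n i ↦ (P n).σ i * (P n).r i) := by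
  simpa using StretchPacking.isDiscCode P (le_refl (1 : ℝ))

/-- The quasiconformal map attached to sequences of packings, and its action on coded points. -/
theorem exists_isQuasiconformal (P Q : ℕ → StretchPacking) (hK : 1 ≤ K) :
    ∃ φ : ℂ ≃ₜ ℂ, IsQuasiconformal K φ ∧ φ 0 = 0 ∧
      ∀ (N : ℕ) (i : Fin (Q N).n) (x : ∀ n, Fin (P n).n),
        φ (newCenter N + (dyadic N / 8) • (Q N).z i +
          ((Q N).σ i ^ K * (dyadic N / 8 * (Q N).r i)) •
            codeLimit (fun n ↦ (P n).z) (fun n i ↦ (P n).σ i ^ K * (P n).r i) x) =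
        newCenter N + (dyadic N / 8) • (Q N).z i +
          ((Q N).σ i * (dyadic N / 8 * (Q N).r i)) •
            codeLimit (fun n ↦ (P n).z) (fun n i ↦ (P n).σ i * (P n).r i) x := by
  obtain ⟨φ, hφ⟩ := exists_homeomorph_of_dist_le (stageMap P Q hK) (dist_stageMap_succ_le hK)
    (dist_stageMap_symm_succ_le hK)
  have hlim : Tendsto (fun n : ℕ ↦ 4 * (1 / 2 : ℝ) ^ n) atTop (𝓝 0) := by
    simpa using (tendsto_pow_atTop_nhds_zero_of_lt_one (by norm_num : (0 : ℝ) ≤ 1 / 2)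
      (by norm_num)).const_mul 4
  have htend (z : ℂ) : Tendsto (fun n ↦ stageMap P Q hK n z) atTop (𝓝 (φ z)) := by
    rw [tendsto_iff_dist_tendsto_zero]
    exact squeeze_zero (fun _ ↦ dist_nonneg) (fun n ↦ hφ n z) hlim
  refine ⟨φ, ?_, ?_, ?_⟩
  -- The constant 8 is `4 + 4`: stage `n` and stage 0, the identity, are both within 4 of `φ`.
  · refine isQuasiconformal_of_eventuallyEq (by linarith) φ (fun n ↦ stageMap P Q hK n) 8
      (exists_lipschitzWith_stageMap hK) (fun n ↦ (stageMap P Q hK n).injective) (fun n z ↦ ?_)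
      (ae_hasDistortion_stageMap hK) (ae_norm_fderiv_stageMap_le hK) ?_
    · have h1 := hφ n z
      have h2 := hφ 0 z
      have h3 : stageMap P Q hK 0 z = z := rfl
      have h4 : (1 / 2 : ℝ) ^ n ≤ 1 := pow_le_one₀ (by norm_num) (by norm_num)
      rw [h3, pow_zero] at h2
      rw [← dist_eq_norm]
      linarith [dist_triangle_right (stageMap P Q hK n z) z (φ z)]
    -- Almost every point lies outside some closed tail, hence has a neighbourhood on which the
    -- stages are eventually constant.
    · have hnull : volume (⋂ N, stageTail P Q K N) = 0 := by
        have h0 : Tendsto (fun N ↦ ENNReal.ofReal (Real.pi * (2 * dyadic N))) atTop (𝓝 0) := by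
          simpa using ENNReal.tendsto_ofReal ((tendsto_dyadic.const_mul 2).const_mul Real.pi)
        refine le_antisymm (ge_of_tendsto' h0 fun N ↦ ?_) zero_le
        exact (measure_mono (iInter_subset _ N)).trans (volume_stageTail_le hK N)
      filter_upwards [compl_mem_ae_iff.2 hnull] with z hz
      simp only [mem_compl_iff, mem_iInter, not_forall] at hz
      obtain ⟨N, hN⟩ := hz
      refine ⟨N, fun n hn ↦ ?_⟩
      filter_upwards [(isClosed_stageTail N).isOpen_compl.mem_nhds hN] with w hw
      rw [stageMap_eq_of_notMem hK hn hw]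
      refine tendsto_nhds_unique (tendsto_const_nhds.congr' ?_) (htend w)
      exact (eventually_ge_atTop N).mono fun m hm ↦ (stageMap_eq_of_notMem hK hm hw).symm
  · refine tendsto_nhds_unique (htend 0) (tendsto_const_nhds.congr fun n ↦ ?_)
    exact (stageMap_of_norm_le hK (by rw [norm_zero]; exact (dyadic_pos n).le)).symm
  · intro N i x
    choose ν hν _ ha _ hb _ using exists_mem_stageNodes (K := K) N i x
    have h1 := ((StretchPacking.isDiscCode P hK).tendsto_codeCenter x).const_smul
      ((Q N).σ i ^ K * (dyadic N / 8 * (Q N).r i))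
    have h2 := ((StretchPacking.isDiscCode_one P).tendsto_codeCenter x).const_smul
      ((Q N).σ i * (dyadic N / 8 * (Q N).r i))
    have h1' := h1.const_add (newCenter N + (dyadic N / 8) • (Q N).z i)
    have h2' := h2.const_add (newCenter N + (dyadic N / 8) • (Q N).z i)
    simp only [← ha] at h1'
    simp only [← hb] at h2'
    refine tendsto_nhds_unique ((φ.continuous.tendsto _).comp h1') ?_
    -- Stage `N + n` sends the source centre exactly to the target centre, and differs from `φ` by a
    -- quantity tending to 0.
    refine tendsto_of_tendsto_of_dist h2' ?_
    have hlim' : Tendsto (fun n : ℕ ↦ 4 * (1 / 2 : ℝ) ^ (N + n)) atTop (𝓝 0) :=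
      hlim.comp (tendsto_add_atTop_nat N |>.congr fun n ↦ add_comm n N)
    refine squeeze_zero (fun _ ↦ dist_nonneg) (fun n ↦ ?_) hlim'
    have h3 := hφ (N + n) (ν n).a
    have h4 : (ν n).a ∈ (ν n).disc := mem_closedBall_self (ν n).s_pos.le
    rw [stageMap_eq_similarity hK _ _ (hν n) _ h4, StretchNode.similarity, sub_self, smul_zero,
      add_zero] at h3
    exact h3

end Stages

/-! ### Unions of copies of a Cantor set -/

open scoped Pointwise in
theorem hausdorffMeasure_image_add_smul {d : ℝ} (hd : 0 ≤ d) (a : ℂ) {ρ : ℝ} (hρ : 0 < ρ)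
    (E : Set ℂ) :
    μH[d] ((fun w ↦ a + ρ • w) '' E) = ENNReal.ofReal (ρ ^ d) * μH[d] E := by
  have e : (fun w ↦ a + ρ • w) '' E = IsometryEquiv.addLeft a '' (ρ • E) := by
    rw [← image_smul, image_image]
    rfl
  rw [e, IsometryEquiv.hausdorffMeasure_image, Measure.hausdorffMeasure_smul₀ hd hρ.ne',
    ← ENNReal.ofReal_rpow_of_pos hρ, ENNReal.smul_def, smul_eq_mul,
    ENNReal.coe_rpow_of_nonneg _ hd]
  congr 2
  rw [Real.nnnorm_of_nonneg hρ.le, ENNReal.ofReal_eq_coe_nnreal hρ.le]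

/-- Countably many disjoint copies of a set of positive and finite measure have infinite and
σ-finite measure in total if the sizes of the copies are large enough. -/
theorem hausdorffMeasure_copies {d : ℝ} (hd : 0 < d) {E F : Set ℂ} (hE : IsCompact E)
    (hE0 : 0 < μH[d] E) (hEt : μH[d] E < ⊤) {m : ℕ → ℕ} (a : ∀ N, Fin (m N) → ℂ)
    (ρ : ∀ N, Fin (m N) → ℝ) (hρ : ∀ N i, 0 < ρ N i)
    (hdisj : Pairwise fun p p' : Σ N, Fin (m N) ↦
      Disjoint ((fun w ↦ a p.1 p.2 + ρ p.1 p.2 • w) '' E)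
        ((fun w ↦ a p'.1 p'.2 + ρ p'.1 p'.2 • w) '' E))
    (hsum : ∀ N, 1 ≤ ∑ i, ρ N i ^ d)
    (hF : F = insert 0 (⋃ p : Σ N, Fin (m N), (fun w ↦ a p.1 p.2 + ρ p.1 p.2 • w) '' E)) :
    μH[d] F = ⊤ ∧ SigmaFinite ((μH[d] : Measure ℂ).restrict F) := by
  set S : (Σ N, Fin (m N)) → Set ℂ := fun p ↦ (fun w ↦ a p.1 p.2 + ρ p.1 p.2 • w) '' E with hS
  have hSm (p) : MeasurableSet (S p) := (hE.image (by fun_prop)).measurableSet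
  have hSμ (p) : μH[d] (S p) = ENNReal.ofReal (ρ p.1 p.2 ^ d) * μH[d] E :=
    hausdorffMeasure_image_add_smul hd.le _ (hρ _ _) E
  have hFm : MeasurableSet F := by
    rw [hF]
    exact (MeasurableSet.iUnion hSm).insert 0
  constructor
  · rw [eq_top_iff]
    calc ⊤ = ∑' _ : ℕ, μH[d] E := (ENNReal.tsum_const_eq_top_of_ne_zero hE0.ne').symm
      _ ≤ ∑' N : ℕ, ∑' i : Fin (m N), μH[d] (S ⟨N, i⟩) := by
          refine ENNReal.tsum_le_tsum fun N ↦ ?_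
          simp only [hSμ]
          rw [tsum_fintype, ← Finset.sum_mul,
            ← ENNReal.ofReal_sum_of_nonneg fun i _ ↦ Real.rpow_nonneg (hρ N i).le d]
          exact le_mul_of_one_le_left zero_le (ENNReal.one_le_ofReal.2 (hsum N))
      _ = ∑' p, μH[d] (S p) := (ENNReal.tsum_sigma' fun p ↦ μH[d] (S p)).symm
      _ = μH[d] (⋃ p, S p) := (measure_iUnion hdisj hSm).symm
      _ ≤ μH[d] F := by rw [hF]; exact measure_mono (subset_insert _ _)
  -- The complement of `F`, null for the restricted measure, and the point 0 complete the copies to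
  -- a countable cover of the plane.
  · refine Measure.sigmaFinite_of_countable (S := insert Fᶜ (insert {0} (range S)))
      (((countable_range S).insert _).insert _) ?_ ?_
    · rintro s (rfl | rfl | ⟨p, rfl⟩)
      · rw [Measure.restrict_apply hFm.compl, compl_inter_self, measure_empty]
        exact ENNReal.zero_lt_top
      · refine (Measure.restrict_apply_le _ _).trans_lt ?_
        have := Measure.nullSingletonClass_hausdorff ℂ hd
        rw [measure_singleton]
        exact ENNReal.zero_lt_top
      · refine (Measure.restrict_apply_le _ _).trans_lt ?_
        rw [hSμ]
        exact ENNReal.mul_lt_top ENNReal.ofReal_lt_top hEt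
    · refine eq_univ_of_forall fun x ↦ ?_
      by_cases hx : x ∈ F
      · rw [hF] at hx
        rcases hx with rfl | hx
        · exact ⟨{0}, by simp, rfl⟩
        · obtain ⟨p, hp⟩ := mem_iUnion.1 hx
          exact ⟨S p, by simp, hp⟩
      · exact ⟨Fᶜ, by simp, hx⟩

/-- All but finitely many of the sets lie in any given ball around 0, so the union with 0 is an
intersection of closed sets, each a finite union together with a ball. -/
theorem isCompact_insert_zero_iUnion {m : ℕ → ℕ} {S : (Σ N, Fin (m N)) → Set ℂ}
    (hS : ∀ p, IsCompact (S p)) (hb : ∀ p, S p ⊆ closedBall 0 (dyadic p.1)) :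
    IsCompact (insert 0 (⋃ p, S p)) := by
  have e : insert 0 (⋃ p, S p) = ⋂ N : ℕ, ((⋃ n ∈ Iio N, ⋃ i : Fin (m n), S ⟨n, i⟩) ∪
      closedBall 0 (dyadic N)) := by
    ext z
    simp only [mem_insert_iff, mem_iUnion, mem_iInter, mem_union, mem_Iio, exists_prop]
    constructor
    · rintro (rfl | ⟨p, hp⟩) N
      · exact Or.inr (mem_closedBall_self (dyadic_pos N).le)
      · rcases lt_or_ge p.1 N with h | h
        · exact Or.inl ⟨p.1, h, p.2, hp⟩
        · exact Or.inr (closedBall_subset_closedBall (dyadic_antitone h) (hb p hp))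
    · intro h
      by_cases hz : z = 0
      · exact Or.inl hz
      · obtain ⟨N, hN⟩ := (tendsto_dyadic.eventually_lt_const (norm_pos_iff.2 hz)).exists
        rcases h N with ⟨n, -, i, hi⟩ | h
        · exact Or.inr ⟨_, hi⟩
        · exact absurd (mem_closedBall_zero_iff.1 h) (not_le.2 hN)
  refine isCompact_of_isClosed_isBounded ?_ ?_
  · rw [e]
    refine isClosed_iInter fun N ↦ IsClosed.union ?_ isClosed_closedBall
    exact (finite_Iio N).isClosed_biUnion fun n _ ↦
      isClosed_iUnion_of_finite fun i ↦ (hS _).isClosed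
  · refine (isBounded_closedBall (x := (0 : ℂ)) (r := dyadic 0)).subset ?_
    rintro z (rfl | hz)
    · exact mem_closedBall_self (dyadic_pos 0).le
    · obtain ⟨p, hp⟩ := mem_iUnion.1 hz
      exact closedBall_subset_closedBall (dyadic_antitone (Nat.zero_le _)) (hb p hp)

/-- The quasiconformal map attached to sequences of packings gives the desired example as soon as
the Cantor sets in the source and in the target have positive and finite measure. -/
theorem exists_compact_isQuasiconformal {K d d' : ℝ} (hK : 1 ≤ K) (hd : 0 < d) (hd' : 0 < d')
    (P Q : ℕ → StretchPacking)
    (hE0 : 0 < μH[d] (range (codeLimit (fun n ↦ (P n).z) fun n i ↦ (P n).σ i ^ K * (P n).r i)))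
    (hEt : μH[d] (range (codeLimit (fun n ↦ (P n).z) fun n i ↦ (P n).σ i ^ K * (P n).r i)) < ⊤)
    (hE0' : 0 < μH[d'] (range (codeLimit (fun n ↦ (P n).z) fun n i ↦ (P n).σ i * (P n).r i)))
    (hEt' : μH[d'] (range (codeLimit (fun n ↦ (P n).z) fun n i ↦ (P n).σ i * (P n).r i)) < ⊤)
    (hQ : ∀ N, 1 ≤ ∑ i, ((Q N).σ i ^ K * (dyadic N / 8 * (Q N).r i)) ^ d)
    (hQ' : ∀ N, 1 ≤ ∑ i, ((Q N).σ i * (dyadic N / 8 * (Q N).r i)) ^ d') :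
    ∃ (F : Set ℂ) (φ : ℂ ≃ₜ ℂ), IsCompact F ∧ IsQuasiconformal K φ ∧
        μH[d] F = ⊤ ∧ SigmaFinite ((μH[d] : Measure ℂ).restrict F) ∧
        μH[d'] (φ '' F) = ⊤ ∧ SigmaFinite ((μH[d'] : Measure ℂ).restrict (φ '' F)) := by
  obtain ⟨φ, hφ, hφ0, hφE⟩ := exists_isQuasiconformal P Q hK
  have hcode := StretchPacking.isDiscCode P hK
  have hcode' := StretchPacking.isDiscCode_one P
  set E := range (codeLimit (fun n ↦ (P n).z) fun n i ↦ (P n).σ i ^ K * (P n).r i) with hEdef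
  set E' := range (codeLimit (fun n ↦ (P n).z) fun n i ↦ (P n).σ i * (P n).r i) with hEdef'
  set a : ∀ N, Fin (Q N).n → ℂ := fun N i ↦ newCenter N + (dyadic N / 8) • (Q N).z i with ha
  set ρ : ∀ N, Fin (Q N).n → ℝ := fun N i ↦ (Q N).σ i ^ K * (dyadic N / 8 * (Q N).r i) with hρdef
  set ρ' : ∀ N, Fin (Q N).n → ℝ := fun N i ↦ (Q N).σ i * (dyadic N / 8 * (Q N).r i) with hρdef'
  set S : (Σ N, Fin (Q N).n) → Set ℂ := fun p ↦ (fun w ↦ a p.1 p.2 + ρ p.1 p.2 • w) '' E with hS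
  set S' : (Σ N, Fin (Q N).n) → Set ℂ := fun p ↦ (fun w ↦ a p.1 p.2 + ρ' p.1 p.2 • w) '' E'
    with hS'
  have hrpos (N : ℕ) (i : Fin (Q N).n) : 0 < dyadic N / 8 * (Q N).r i :=
    mul_pos (dyadic_div_eight_pos N) ((Q N).r_pos i)
  have hρ (N : ℕ) (i : Fin (Q N).n) : 0 < ρ N i :=
    mul_pos (Real.rpow_pos_of_pos ((Q N).σ_pos i) K) (hrpos N i)
  have hρ' (N : ℕ) (i : Fin (Q N).n) : 0 < ρ' N i := mul_pos ((Q N).σ_pos i) (hrpos N i)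
  have himage (p) : φ '' S p = S' p := by
    simp only [hS, hS', hEdef, hEdef', ← range_comp, Function.comp_def]
    exact congrArg range (funext fun x ↦ hφE p.1 p.2 x)
  have hSball (p) : S p ⊆ closedBall (a p.1 p.2) (dyadic p.1 / 8 * (Q p.1).r p.2) := by
    rintro _ ⟨_, ⟨x, rfl⟩, rfl⟩
    have h1 := hcode.dist_limit_center_le x 0
    simp only [codeCenter, codeScale, Finset.range_zero, Finset.sum_empty, Finset.prod_empty,
      dist_zero_right] at h1
    rw [mem_closedBall, dist_eq_norm, add_sub_cancel_left, norm_smul,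
      Real.norm_of_nonneg (hρ _ _).le]
    have h2 : (Q p.1).σ p.2 ^ K ≤ 1 := Real.rpow_le_one ((Q p.1).σ_pos _).le
      (by linarith [(Q p.1).σ_le p.2]) (by linarith)
    have h3 := hrpos p.1 p.2
    have h4 := hρ p.1 p.2
    have h5 : ρ p.1 p.2 ≤ dyadic p.1 / 8 * (Q p.1).r p.2 := mul_le_of_le_one_left h3.le h2
    nlinarith
  have hSnew (p) : S p ⊆ closedBall (newCenter p.1) (dyadic p.1 / 8) := (hSball p).trans
    (closedBall_add_smul_subset (dyadic_div_eight_pos _) ((Q p.1).norm_add_le p.2))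
  have hdisj : Pairwise fun p p' ↦ Disjoint (S p) (S p') := by
    have hlt (p p' : Σ N, Fin (Q N).n) (h : p.1 < p'.1) : Disjoint (S p) (S p') :=
      disjoint_left.2 fun z hz hz' ↦ by
        have h1 := (norm_bounds_of_mem_newBall (hSnew p hz)).1
        have h2 := (norm_bounds_of_mem_newBall (hSnew p' hz')).2
        exact (h1.trans h2).not_ge (dyadic_antitone h)
    intro p p' hne
    rcases lt_trichotomy p.1 p'.1 with h | h | h
    · exact hlt p p' h
    · obtain ⟨N, i⟩ := p
      obtain ⟨N', i'⟩ := p'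
      obtain rfl : N = N' := h
      have hi : i ≠ i' := fun h ↦ hne (by rw [h])
      exact (disjoint_closedBall_add_smul (dyadic_div_eight_pos N) ((Q N).r_pos i).le
        ((Q N).r_pos i').le ((Q N).disjoint hi)).mono (hSball ⟨N, i⟩) (hSball ⟨N, i'⟩)
    · exact (hlt p' p h).symm
  -- Disjointness in the target is inherited from the source by injectivity of `φ`.
  have hdisj' : Pairwise fun p p' ↦ Disjoint (S' p) (S' p') := fun p p' hne ↦ by
    simp only [← himage]
    exact (disjoint_image_iff φ.injective).2 (hdisj hne)
  have hFimage : φ '' insert 0 (⋃ p, S p) = insert 0 (⋃ p, S' p) := by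
    rw [image_insert_eq, hφ0, image_iUnion]
    simp only [himage]
  obtain ⟨h1, h2⟩ := hausdorffMeasure_copies hd hcode.isCompact_range hE0 hEt a ρ hρ hdisj hQ rfl
  obtain ⟨h3, h4⟩ :=
    hausdorffMeasure_copies hd' hcode'.isCompact_range hE0' hEt' a ρ' hρ' hdisj' hQ' rfl
  refine ⟨insert 0 (⋃ p, S p), φ, ?_, hφ, h1, h2, ?_, ?_⟩
  · refine isCompact_insert_zero_iUnion (fun p ↦ hcode.isCompact_range.image (by fun_prop))
      fun p z hz ↦ ?_
    rw [mem_closedBall_zero_iff]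
    exact (norm_bounds_of_mem_newBall (hSnew p hz)).2.le
  · rw [hFimage]
    exact h3
  · rw [hFimage]
    exact h4

/-! ### The choice of the packings -/

/-- As `d < 2`, `r²` is negligible against `r^d`. The factor 2 offsets packings that fill only half
of the area. -/
theorem exists_radius_two_mul_sq_le {c d : ℝ} (hc : 0 < c) (hd : d < 2) :
    ∃ δ > 0, ∀ r, 0 < r → r ≤ δ → 2 * r ^ 2 ≤ (c * r) ^ d := by
  have hlim : Tendsto (fun r : ℝ ↦ r ^ (2 - d)) (𝓝 0) (𝓝 0) := by
    have := (Real.continuousAt_rpow_const 0 (2 - d) (Or.inr (by linarith))).tendsto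
    rwa [Real.zero_rpow (by linarith)] at this
  have hev := hlim.eventually_lt_const (show 0 < c ^ d / 2 by positivity)
  obtain ⟨ε, hε, h⟩ := Metric.eventually_nhds_iff.1 hev
  refine ⟨ε / 2, by positivity, fun r hr hrε ↦ ?_⟩
  have h1 : r ^ (2 - d) < c ^ d / 2 := h (by
    rw [dist_zero_right, Real.norm_of_nonneg hr.le]
    linarith)
  have h2 : r ^ (2 : ℕ) = r ^ (2 - d) * r ^ d := by
    rw [← Real.rpow_add hr, ← Real.rpow_natCast]
    norm_num
  rw [Real.mul_rpow hc.le hr.le, h2]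
  have := Real.rpow_pos_of_pos hr d
  nlinarith

/-- Packings for which the total size of the discs is at least one in two given dimensions. -/
theorem exists_stretchPacking_one_le {d d' c c' : ℝ} (hd : d < 2) (hd' : d' < 2) (hc : 0 < c)
    (hc' : 0 < c') : ∃ R : StretchPacking, (∀ i, R.σ i = 1 / 2) ∧
      1 ≤ ∑ i, (c * R.r i) ^ d ∧ 1 ≤ ∑ i, (c' * R.r i) ^ d' := by
  obtain ⟨δ, hδ, h⟩ := exists_radius_two_mul_sq_le hc hd
  obtain ⟨δ', hδ', h'⟩ := exists_radius_two_mul_sq_le hc' hd'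
  obtain ⟨n, z, r, hr, hrδ, hz, hdisj, hsum⟩ := exists_disc_packing (lt_min hδ hδ')
    (show (1 / 2 : ℝ) < 1 by norm_num)
  have h2 : 1 ≤ ∑ i, 2 * r i ^ 2 := by
    rw [← Finset.mul_sum]
    linarith
  exact ⟨⟨n, z, r, fun _ ↦ 1 / 2, hr, fun _ ↦ by norm_num, fun _ ↦ le_rfl, hz, hdisj⟩,
    fun _ ↦ rfl,
    h2.trans (Finset.sum_le_sum fun i _ ↦ h _ (hr i) ((hrδ i).trans (min_le_left _ _))),
    h2.trans (Finset.sum_le_sum fun i _ ↦ h' _ (hr i) ((hrδ i).trans (min_le_right _ _)))⟩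

/-- Packings with ratios adapted to the dimension `d'` in the target, covering all but a small part
of the area of the disc. -/
theorem exists_stretchPacking_critical {d' η : ℝ} (hd0 : 0 < d') (hd : d' < 2) (hη : 1 / 2 ≤ η)
    (hη1 : η < 1) : ∃ R : StretchPacking, η ≤ ∑ i, R.r i ^ 2 ∧
      ∀ i, (R.σ i * R.r i) ^ d' = R.r i ^ 2 / ∑ j, R.r j ^ 2 := by
  -- The choice `c = 1 / 2` yields `r² / S ≤ (r / 2)^d'`, which is the requirement `σ ≤ 1 / 2`.
  obtain ⟨δ, hδ, h⟩ := exists_radius_two_mul_sq_le (c := 1 / 2) (by norm_num) hd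
  obtain ⟨n, z, r, hr, hrδ, hz, hdisj, hsum⟩ := exists_disc_packing hδ hη1
  set S := ∑ j, r j ^ 2 with hS
  have hS0 : 0 < S := by linarith
  have hp (i : Fin n) : 0 < r i ^ 2 / S := div_pos (pow_pos (hr i) 2) hS0
  refine ⟨⟨n, z, r, fun i ↦ (r i ^ 2 / S) ^ d'⁻¹ / r i, hr,
    fun i ↦ div_pos (Real.rpow_pos_of_pos (hp i) _) (hr i), fun i ↦ ?_, hz, hdisj⟩, hsum,
    fun i ↦ ?_⟩
  · have h1 : r i ^ 2 / S ≤ 2 * r i ^ 2 := by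
      rw [div_le_iff₀ hS0]
      nlinarith [pow_pos (hr i) 2]
    rw [div_le_iff₀ (hr i)]
    calc (r i ^ 2 / S) ^ d'⁻¹ ≤ ((1 / 2 * r i) ^ d') ^ d'⁻¹ := by
          exact Real.rpow_le_rpow (hp i).le (h1.trans (h _ (hr i) (hrδ i))) (by positivity)
      _ = 1 / 2 * r i := Real.rpow_rpow_inv (by linarith [hr i]) hd0.ne'
  · simp only
    rw [div_mul_cancel₀ _ (hr i).ne', Real.rpow_inv_rpow (hp i).le hd0.ne']

/-- Sharp examples in all dimensions `0 < d < 2`. -/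
theorem exists_compact_isQuasiconformal_of_dim {K d : ℝ} (hK : 1 ≤ K) (hd0 : 0 < d) (hd2 : d < 2) :
    ∃ (F : Set ℂ) (φ : ℂ ≃ₜ ℂ), IsCompact F ∧ IsQuasiconformal K φ ∧
        μH[d] F = ⊤ ∧ SigmaFinite ((μH[d] : Measure ℂ).restrict F) ∧
        μH[2 * K * d / (2 + (K - 1) * d)] (φ '' F) = ⊤ ∧
        SigmaFinite
          ((μH[2 * K * d / (2 + (K - 1) * d)] : Measure ℂ).restrict (φ '' F)) := by
  set d' := 2 * K * d / (2 + (K - 1) * d) with hd'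
  set γ := (K - 1) * d / 2 with hγ
  have hγ0 : 0 ≤ γ := by
    have : 0 ≤ K - 1 := by linarith
    positivity
  have hden : 0 < 2 + (K - 1) * d := by linarith
  have hd'0 : 0 < d' := by positivity
  have hd'2 : d' < 2 := by
    rw [hd', div_lt_iff₀ hden]
    nlinarith
  -- This is the relation between the two dimensions that makes all powers of `r` cancel in
  -- `hsource`.
  have hdγ : K * d = d' * (1 + γ) := by
    rw [hd', hγ, div_mul_eq_mul_div, eq_div_iff hden.ne']
    ring
  -- The packings `Q` use `σ = 1 / 2`, so the copies have sizes `(1/2)^K` and `1/2` times the disc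
  -- radii.
  choose Q hQσ hQ hQ' using fun N ↦ exists_stretchPacking_one_le (d := d) (d' := d') hd2 hd'2
    (mul_pos (show (0 : ℝ) < (1 / 2) ^ K by positivity) (dyadic_div_eight_pos N))
    (mul_pos (show (0 : ℝ) < 1 / 2 by positivity) (dyadic_div_eight_pos N))
  -- The filling rates tend to 1 so fast that their infinite product is positive.
  have hη (n : ℕ) : 1 / 2 ≤ Real.exp (-(dyadic n / 4)) ∧ Real.exp (-(dyadic n / 4)) < 1 := by
    have h1 : dyadic n ≤ 1 := dyadic_antitone n.zero_le |>.trans_eq (by simp [dyadic])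
    have h2 := Real.add_one_le_exp (-(dyadic n / 4))
    have h3 := dyadic_pos n
    exact ⟨by linarith, Real.exp_zero ▸ Real.exp_lt_exp.2 (by linarith)⟩
  choose P hPS hP using fun n ↦ exists_stretchPacking_critical hd'0 hd'2 (hη n).1 (hη n).2
  set S : ℕ → ℝ := fun n ↦ ∑ j, (P n).r j ^ 2 with hS
  have hS0 (n : ℕ) : 1 / 2 ≤ S n := (hη n).1.trans (hPS n)
  have hSpos (n : ℕ) : 0 < S n := by linarith [hS0 n]
  have hS1 (n : ℕ) : S n ≤ 1 := (P n).sum_sq_le_one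
  set p : ∀ n, Fin (P n).n → ℝ := fun n i ↦ (P n).r i ^ 2 / S n with hp
  have hp0 (n i) : 0 < p n i := div_pos (pow_pos ((P n).r_pos i) 2) (hSpos n)
  have hp1 (n) : ∑ i, p n i = 1 := by
    simp only [hp, ← Finset.sum_div]
    exact div_self (hSpos n).ne'
  have hpr (n i) : p n i ≤ 2 * (P n).r i ^ 2 := by
    simp only [hp]
    rw [div_le_iff₀ (hSpos n)]
    nlinarith [hS0 n, pow_pos ((P n).r_pos i) 2]
  have hsource (n i) : ((P n).σ i ^ K * (P n).r i) ^ d = p n i * S n ^ (-γ) := by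
    have hr := (P n).r_pos i
    have hσ := (P n).σ_pos i
    have h1 : (P n).σ i ^ d' = p n i * (P n).r i ^ (-d') := by
      have := hP n i
      rw [Real.mul_rpow hσ.le hr.le] at this
      rw [Real.rpow_neg hr.le, ← div_eq_mul_inv, eq_div_iff (by positivity)]
      exact this
    have h2 : p n i ^ (1 + γ) = p n i * ((P n).r i ^ (2 * γ) * S n ^ (-γ)) := by
      rw [Real.rpow_add (hp0 n i), Real.rpow_one]
      congr 1
      simp only [hp]
      rw [Real.div_rpow (by positivity) (hSpos n).le, Real.rpow_neg (hSpos n).le, ← div_eq_mul_inv,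
        ← Real.rpow_natCast, ← Real.rpow_mul hr.le]
      norm_num
    rw [Real.mul_rpow (by positivity) hr.le, ← Real.rpow_mul hσ.le, hdγ, Real.rpow_mul hσ.le, h1,
      Real.mul_rpow (hp0 n i).le (by positivity), h2, ← Real.rpow_mul hr.le]
    have h3 : (P n).r i ^ (2 * γ) * (P n).r i ^ (-d' * (1 + γ)) * (P n).r i ^ d = 1 := by
      rw [← Real.rpow_add hr, ← Real.rpow_add hr]
      have : 2 * γ + -d' * (1 + γ) + d = 0 := by
        rw [neg_mul, ← hdγ, hγ]
        ring
      rw [this, Real.rpow_zero]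
    linear_combination (p n i * S n ^ (-γ)) * h3
  have hSγ (n) : 1 ≤ S n ^ (-γ) :=
    Real.one_le_rpow_of_pos_of_le_one_of_nonpos (hSpos n) (hS1 n) (by linarith)
  have hSγ' (n) : S n ^ (-γ) ≤ Real.exp (dyadic n / 4 * γ) := by
    calc S n ^ (-γ) ≤ Real.exp (-(dyadic n / 4)) ^ (-γ) :=
          Real.rpow_le_rpow_of_nonpos (Real.exp_pos _) (hPS n) (by linarith)
      _ = _ := by rw [← Real.exp_mul]; congr 1; ring
  have hσ1 (n i) : (P n).σ i ^ K ≤ (P n).σ i := by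
    have := Real.rpow_le_rpow_of_exponent_ge ((P n).σ_pos i)
      (by linarith [(P n).σ_le i]) hK
    rwa [Real.rpow_one] at this
  have hqr' (n i) : 2 * ((P n).σ i * (P n).r i) ≤ (P n).r i := by
    nlinarith [(P n).σ_le i, (P n).r_pos i]
  have hqr (n i) : 2 * ((P n).σ i ^ K * (P n).r i) ≤ (P n).r i := by
    nlinarith [hqr' n i, hσ1 n i, (P n).r_pos i]
  have hcode := StretchPacking.isDiscCode P hK
  have hcode' := StretchPacking.isDiscCode_one P
  refine exists_compact_isQuasiconformal hK hd0 hd'0 P Q ?_ ?_ ?_ ?_ (fun N ↦ ?_) (fun N ↦ ?_)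
  · refine hcode.hausdorffMeasure_range_pos hd0 hd2.le hqr (fun n ↦ (P n).disjoint)
      (fun n i ↦ (hp0 n i).le) hp1 hpr fun n i ↦ ?_
    -- In the source the mass is dominated because `S ≤ 1` gives `S ^ (-γ) ≥ 1`.
    rw [hsource]
    exact le_mul_of_one_le_right (hp0 n i).le (hSγ n)
  · refine hcode.hausdorffMeasure_range_lt_top hd0 (C := Real.exp γ) fun n ↦ ?_
    have h1 : ∀ j, ∑ i, ((P j).σ i ^ K * (P j).r i) ^ d ≤ Real.exp (dyadic j / 4 * γ) := fun j ↦ by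
      simp only [hsource]
      rw [← Finset.sum_mul, hp1, one_mul]
      exact hSγ' j
    refine (Finset.prod_le_prod (fun j _ ↦ Finset.sum_nonneg fun i _ ↦ by
      rw [hsource]
      exact mul_nonneg (hp0 j i).le (Real.rpow_nonneg (hSpos j).le _)) fun j _ ↦ h1 j).trans ?_
    rw [← Real.exp_sum, ← Finset.sum_mul, ← Finset.sum_div, Real.exp_le_exp]
    -- The total exponent is at most `γ / 2`, below the `γ` allowed by the constant.
    have h2 : ∑ j ∈ Finset.range n, dyadic j ≤ 2 := by
      have := (summable_geometric_two).sum_le_tsum (Finset.range n) fun j _ ↦ by positivity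
      rwa [tsum_geometric_two] at this
    nlinarith
  · refine hcode'.hausdorffMeasure_range_pos hd'0 hd'2.le hqr' (fun n ↦ (P n).disjoint)
      (fun n i ↦ (hp0 n i).le) hp1 hpr fun n i ↦ (hP n i).ge
  · refine hcode'.hausdorffMeasure_range_lt_top hd'0 (C := 1) fun n ↦ ?_
    refine (Finset.prod_eq_one fun j _ ↦ ?_).le
    simp only [hP]
    exact hp1 j
  · refine (hQ N).trans_eq (Finset.sum_congr rfl fun i _ ↦ ?_)
    rw [hQσ, mul_assoc]
  · refine (hQ' N).trans_eq (Finset.sum_congr rfl fun i _ ↦ ?_)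
    rw [hQσ, mul_assoc]

theorem corollary3p5 (K : ℝ) (hK : 1 ≤ K) :
    (∃ (F : Set ℂ) (φ : ℂ ≃ₜ ℂ), IsCompact F ∧ IsQuasiconformal K φ ∧
      μH[2 / (K + 1)] F = ⊤ ∧
      SigmaFinite ((μH[2 / (K + 1)] : Measure ℂ).restrict F) ∧
      μH[1] (φ '' F) = ⊤ ∧
      SigmaFinite ((μH[1] : Measure ℂ).restrict (φ '' F))) ∧
    ∀ d : ℝ, 0 < d → d < 2 →
      ∃ (F : Set ℂ) (φ : ℂ ≃ₜ ℂ), IsCompact F ∧ IsQuasiconformal K φ ∧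
        μH[d] F = ⊤ ∧
        SigmaFinite ((μH[d] : Measure ℂ).restrict F) ∧
        μH[2 * K * d / (2 + (K - 1) * d)] (φ '' F) = ⊤ ∧
        SigmaFinite
          ((μH[2 * K * d / (2 + (K - 1) * d)] : Measure ℂ).restrict (φ '' F)) := by
  refine ⟨?_, fun d hd0 hd2 ↦ exists_compact_isQuasiconformal_of_dim hK hd0 hd2⟩
  have hK1 : 0 < K + 1 := by linarith
  have h := exists_compact_isQuasiconformal_of_dim (d := 2 / (K + 1)) hK (by positivity)
    (by rw [div_lt_iff₀ hK1]; linarith)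
  -- The first assertion is the case `d = 2 / (K + 1)`, whose target dimension is 1.
  have e : 2 * K * (2 / (K + 1)) / (2 + (K - 1) * (2 / (K + 1))) = 1 := by
    have h1 : 2 + (K - 1) * (2 / (K + 1)) = 4 * K / (K + 1) := by
      field_simp
      ring
    have hK0 : K ≠ 0 := by linarith
    rw [h1]
    field_simp
    norm_num
  rwa [e] at h
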